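/- A planar doodle diagram is a connected $4$-valent graph $D$ (multiple edges and loops allowed, at least one vertex) embedded in the sphere; its vertices are called crossings and the components of its complement are called regions. A region is an $i$-gon if its boundary curve consists of $i$ edges. $D$ is minimal if it has no monogon and no bigon, and prime if its graph is $3$-connected (it has more than three vertices and the removal of at most two vertices never disconnects it). Let $D$ be a prime minimal planar doodle diagram with $n$ crossings, and let $f_i$ be the number of its $i$-gon regions. Choose a region of $D$, the infinite region, and let $p$ be its number of edges. Let $\Gamma$ be the dual graph of $D$, embedded in the sphere: it has one vertex for each region of $D$, and for each edge of $D$ one edge, joining the vertices of the two regions on its sides; the regions of $\Gamma$ are the components of its complement. Let $v_\infty$ be the vertex of $\Gamma$ that corresponds to the infinite region, let $\Delta$ be the union of all closed cells (vertices, edges and regions) of this cell decomposition of the sphere that do not contain $v_\infty$, and let $\Gamma' = \Gamma - v_\infty$ be the graph obtained by deleting $v_\infty$ and all edges at it. Then $\Delta$ is a disc, with a cell decomposition whose $1$-skeleton is $\Gamma'$ and whose boundary is an embedded circle in $\Gamma'$, and: 1. $\Gamma$ has $n+2$ vertices, $2n$ edges and $n$ regions. 2. $\Gamma'$ has $n+1$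 vertices. 3. The boundary of $\Delta$ contains $2p$ edges and $2p$ vertices. 4. $\Delta$ has $2n-3p$ interior edges and $n+1-2p$ interior vertices. 5. $\Delta$ has $n-p$ regions, all four-sided (bounded by an embedded circle of four edges and four vertices). 6. Among the vertices of $\Gamma'$, exactly $f_p-1$ have valency $p$ in $\Gamma$, and for each $i\ge 3$ with $i\ne p$ exactly $f_i$ have valency $i$ in $\Gamma$ (so edges to $v_\infty$ are counted in the valency). 7. Every region of $\Delta$ is adjacent, along an edge, to at least two other regions of $\Delta$. 8. Any two vertices of $\Gamma$ are joined by at most one edge of $\Gamma$. -/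

import Mathlib

/-- A cellular decomposition of a closed oriented surface, encoded as a combinatorial map
(a graph together with the cyclic order of the edge ends at every vertex).
An element of `δ` is a *dart*: an edge with a chosen direction, identified with the end
of the edge at the vertex from which it leaves.
`rot` sends a dart to the next one counterclockwise about its starting vertex and `flip` reverses
the direction. The surface is obtained by gluing a polygon to every closed boundary walk. -/
structure CellMap (δ : Type*) where
  rot : Equiv.Perm δ
  flip : Equiv.Perm δ
  flip_flip : ∀ d, flip (flip d) = d
  flip_ne : ∀ d, flip d ≠ d

namespace CellMap

variable {δ : Type*} (M : CellMap δ)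

/-- Walk along a dart and turn so as to keep on the boundary of the face on its left:
this traces the boundary of that face counterclockwise. -/
def turn : Equiv.Perm δ := M.rot⁻¹ * M.flip

/-- Vertices are the cycles of `rot`. -/
def Vertex : Type _ := Quotient (Equiv.Perm.SameCycle.setoid M.rot)

/-- (Undirected) edges are the pairs of opposite darts. -/
def Edge : Type _ := Quotient (Equiv.Perm.SameCycle.setoid M.flip)

/-- Faces are the closed boundary walks, i.e. the cycles of `turn`. -/
def Face : Type _ := Quotient (Equiv.Perm.SameCycle.setoid M.turn)

/-- The vertex from which a dart leaves. -/
def vertex (d : δ) : M.Vertex := Quotient.mk (Equiv.Perm.SameCycle.setoid M.rot) d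

/-- The edge underlying a dart. -/
def edge (d : δ) : M.Edge := Quotient.mk (Equiv.Perm.SameCycle.setoid M.flip) d

/-- The face on the left of a dart. -/
def face (d : δ) : M.Face := Quotient.mk (Equiv.Perm.SameCycle.setoid M.turn) d

/-- The valency of a vertex: the number of edge ends at it. -/
noncomputable def valency (v : M.Vertex) : ℕ := Nat.card {d // M.vertex d = v}

/-- The number of edges in the boundary walk of a face. -/
noncomputable def sides (f : M.Face) : ℕ := Nat.card {d // M.face d = f}

/-- The edge `e` joins the vertices `u` and `w`. -/
def Joins (e : M.Edge) (u w : M.Vertex) : Prop :=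
  ∃ d, M.edge d = e ∧ M.vertex d = u ∧ M.vertex (M.flip d) = w

/-- The vertex `v` is an end of the edge `e`. -/
def IsEnd (v : M.Vertex) (e : M.Edge) : Prop := ∃ d, M.edge d = e ∧ M.vertex d = v

/-- The vertex `v` lies in the boundary of the face `f`. -/
def IsCorner (v : M.Vertex) (f : M.Face) : Prop := ∃ d, M.face d = f ∧ M.vertex d = v

/-- The edge `e` lies in the boundary of the face `f`. -/
def IsSide (e : M.Edge) (f : M.Face) : Prop := ∃ d, M.edge d = e ∧ M.face d = f

/-- Two faces are adjacent if some edge has one of them on either side. -/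
def FaceAdj (f g : M.Face) : Prop := ∃ d, M.face d = f ∧ M.face (M.flip d) = g

/-- The face is four-sided: its boundary is an embedded circle made of four different edges
and four different vertices. -/
def IsFourSided (f : M.Face) : Prop :=
  M.sides f = 4 ∧ Set.InjOn M.edge {d | M.face d = f} ∧ Set.InjOn M.vertex {d | M.face d = f}

/-- The simple graph on the vertices, two different ones being adjacent
if they are joined by an edge. -/
def graph : SimpleGraph M.Vertex where
  Adj u w := u ≠ w ∧ ∃ e, M.Joins e u w
  symm := ⟨by
    rintro u w ⟨h, _, d, rfl, hu, hw⟩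
    exact ⟨h.symm, _, M.flip d, rfl, hw, by rw [M.flip_flip]; exact hu⟩⟩
  loopless := ⟨fun _ h => h.1 rfl⟩

/-- The Jordan curve property modulo 2: whenever a set `C` of edges has an even number of ends
at every vertex, the faces fall into two classes such that the edges of `C` are those with one
side in each class. In other words the first homology group modulo 2 of the surface vanishes. Among
the closed connected surfaces this singles out the sphere. -/
def IsPlanar : Prop :=
  ∀ C : Set M.Edge, (∀ v, Even (Nat.card {d // M.vertex d = v ∧ M.edge d ∈ C})) →
    ∃ S : Set M.Face, ∀ d, M.edge d ∈ C ↔ Xor (M.face d ∈ S) (M.face (M.flip d) ∈ S)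

/-- The dual cell decomposition on the same surface: its vertices are the faces of `M`. The dart
`d` now stands for the dual edge crossing `d` from its left to its right. -/
def dual : CellMap δ where
  rot := M.turn
  flip := M.flip
  flip_flip := M.flip_flip
  flip_ne := M.flip_ne

/-- The vertex of the dual decomposition that corresponds to a face. -/
def dualVertex (f : M.Face) : M.dual.Vertex := f

/-- A subcomplex: a set of cells that contains all cells in the boundary of each of its cells. -/
structure Subcomplex where
  verts : Set M.Vertex
  edges : Set M.Edge
  faces : Set M.Face
  ends_mem : ∀ e ∈ edges, ∀ v, M.IsEnd v e → v ∈ verts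
  sides_mem : ∀ f ∈ faces, ∀ e, M.IsSide e f → e ∈ edges

theorem vertex_turn (d : δ) : M.vertex (M.turn d) = M.vertex (M.flip d) := by
  refine Quotient.sound (s := Equiv.Perm.SameCycle.setoid M.rot) ?_
  exact ⟨1, by simp [turn]⟩

theorem face_turn (d : δ) : M.face (M.turn d) = M.face d := by
  refine Quotient.sound (s := Equiv.Perm.SameCycle.setoid M.turn) ?_
  exact ⟨-1, by simp⟩

theorem eq_or_eq_flip {d d' : δ} (h : M.edge d = M.edge d') : d' = d ∨ d' = M.flip d := by
  obtain ⟨i, hi⟩ : Equiv.Perm.SameCycle M.flip d d' := Quotient.exact h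
  have h2 : M.flip ^ (2 : ℤ) = 1 := by
    ext x
    simp [zpow_ofNat, pow_two, M.flip_flip]
  rcases Int.even_or_odd' i with ⟨k, rfl | rfl⟩
  · left
    simpa [zpow_mul, h2] using hi.symm
  · right
    simpa [zpow_add, zpow_mul, h2] using hi.symm

/-- The complement of the open star of a vertex `v`: all closed cells that avoid `v`. -/
def awayFrom (v : M.Vertex) : M.Subcomplex where
  verts := {w | w ≠ v}
  edges := {e | ¬ M.IsEnd v e}
  faces := {f | ¬ M.IsCorner v f}
  ends_mem := by
    rintro e he w hw rfl
    exact he hw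
  sides_mem := by
    rintro _ hf _ ⟨d, rfl, rfl⟩ ⟨d', hd', rfl⟩
    rcases M.eq_or_eq_flip hd'.symm with rfl | rfl
    · exact hf ⟨_, rfl, rfl⟩
    · exact hf ⟨M.turn d, M.face_turn d, M.vertex_turn d⟩

namespace Subcomplex

variable {M} (K : M.Subcomplex)

/-- The 1-skeleton of a subcomplex (as a simple graph). -/
def skeleton : SimpleGraph K.verts where
  Adj u w := u ≠ w ∧ ∃ e ∈ K.edges, M.Joins e u w
  symm := ⟨by
    rintro u w ⟨h, _, he, d, rfl, hu, hw⟩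
    refine ⟨h.symm, _, he, M.flip d, ?_, hw, by rw [M.flip_flip]; exact hu⟩
    exact Quotient.sound (s := Equiv.Perm.SameCycle.setoid M.flip) ⟨-1, by simp⟩⟩
  loopless := ⟨fun _ h => h.1 rfl⟩

/-- The vertices on the topological boundary: those in contact with a face outside. -/
def boundaryVerts : Set M.Vertex := {v ∈ K.verts | ∃ f ∉ K.faces, M.IsCorner v f}

/-- The edges on the topological boundary: those in contact with a face outside. -/
def boundaryEdges : Set M.Edge := {e ∈ K.edges | ∃ f ∉ K.faces, M.IsSide e f}

def interiorVerts : Set M.Vertex := K.verts \ K.boundaryVerts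

def interiorEdges : Set M.Edge := K.edges \ K.boundaryEdges

/-- The boundary is a single embedded circle: its vertices and its edges can be numbered
cyclically, without repetition, so that each edge joins its vertex to the next one. -/
def BoundaryIsCircle : Prop :=
  ∃ m : ℕ, 0 < m ∧ ∃ (b : ZMod m → M.Vertex) (c : ZMod m → M.Edge),
    Function.Injective b ∧ Function.Injective c ∧
    Set.range b = K.boundaryVerts ∧ Set.range c = K.boundaryEdges ∧
    ∀ i, M.Joins (c i) (b i) (b (i + 1))

/-- The subcomplex is a disc: a connected piece of the surface, bounded by one embedded circle,
with Euler characteristic 1. -/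
def IsDisc : Prop :=
  K.skeleton.Connected ∧ K.BoundaryIsCircle ∧
    (K.verts.ncard : ℤ) - K.edges.ncard + K.faces.ncard = 1

end Subcomplex

end CellMap

/-- A graph is `k`-connected if it has more than `k` vertices and is not disconnected
by the removal of fewer than `k` vertices. -/
def SimpleGraph.IsKConnected {V : Type*} (G : SimpleGraph V) (k : ℕ) : Prop :=
  k < Nat.card V ∧ ∀ S : Set V, S.ncard < k → (G.induce Sᶜ).Connected

/-- A planar (irreducible, non-trivial) doodle diagram: a connected 4-valent graph in the sphere.
The components are recovered by going straight across at every crossing. Orientations of the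
components play no role. -/
structure DoodleDiagram (δ : Type*) extends CellMap δ where
  four_valent : ∀ v, toCellMap.valency v = 4
  connected : toCellMap.graph.Connected
  planar : toCellMap.IsPlanar

namespace DoodleDiagram

variable {δ : Type*} (D : DoodleDiagram δ)

abbrev Crossing : Type _ := D.toCellMap.Vertex

abbrev Region : Type _ := D.toCellMap.Face

/-- The diagram (which is connected) has no monogon and no bigon. -/
def IsMinimal : Prop := ∀ R : D.Region, 3 ≤ D.toCellMap.sides R

/-- The underlying graph is 3-connected. -/
def IsPrime : Prop := D.toCellMap.graph.IsKConnected 3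

/-- The dual graph, with its embedding in the sphere. -/
abbrev dualGraph : CellMap δ := D.toCellMap.dual

/-- The vertex of the dual graph that corresponds to a region. -/
abbrev regionVertex (R : D.Region) : D.dualGraph.Vertex := D.toCellMap.dualVertex R

/-- The number of `i`-gon regions. -/
noncomputable def numGons (i : ℕ) : ℕ := Nat.card {R : D.Region // D.toCellMap.sides R = i}

end DoodleDiagram

/-! The counts follow from Euler's formula, the geometry from a Jordan curve argument. Planarity
says that the complex of faces, edges and vertices modulo 2 is exact at the edges. The graph and its
dual being connected, counting dimensions gives $V - E + F = 2$ and exactness of the transposed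
complex (`Matrix.euler_and_dual_exact`): a set of edges meeting every region evenly consists of the
edges across a 2-colouring of the crossings.

Such sets arise from closed curves made of small arcs about crossings (`arcChain`). If the curve
meets only edges at one or two crossings, 3-connectedness makes the colouring constant on all
others, which severely restricts the curve. Thus a region touches a crossing only once
(`eq_of_vertex_face`), and two regions with two common crossings share an edge between these
(`exists_common_edge`). The latter needs that parallel edges do not exist (`eq_of_parallel`): one
side of a 2-cycle would contain no further crossing, hence a region with at most two sides.

The claims about the disc all come from `exists_common_edge`. At each corner of the infinite region,
list the region across an edge and the opposite region; going once around gives $2p$ regions, which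
are distinct (`boundary_face_inj`) and form the boundary circle. -/

theorem Equiv.Perm.card_sameCycle {α : Type*} [Finite α] (σ : Equiv.Perm α) (x : α) :
    Nat.card {y // σ.SameCycle x y} = Function.minimalPeriod σ x := by
  have hpos : 0 < Function.minimalPeriod σ x :=
    Function.minimalPeriod_pos_of_mem_periodicPts
      (Function.Injective.mem_periodicPts σ.injective x)
  have e : Function.Bijective (fun i : Fin (Function.minimalPeriod σ x) =>
      (⟨(σ ^ (i : ℕ)) x, ⟨i, by simp⟩⟩ : {y // σ.SameCycle x y})) := by
    constructor
    · intro i j h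
      have h' : (σ ^ (i : ℕ)) x = (σ ^ (j : ℕ)) x := congrArg Subtype.val h
      rw [← Equiv.Perm.iterate_eq_pow, ← Equiv.Perm.iterate_eq_pow] at h'
      exact Fin.ext ((Function.iterate_eq_iterate_iff_of_lt_minimalPeriod i.2 j.2).1 h')
    · rintro ⟨y, hy⟩
      obtain ⟨i, -, hi⟩ := hy.exists_pow_eq'
      refine ⟨⟨i % _, Nat.mod_lt _ hpos⟩, Subtype.ext ?_⟩
      change (σ ^ (i % _)) x = y
      rw [← hi, ← Equiv.Perm.iterate_eq_pow, ← Equiv.Perm.iterate_eq_pow,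
        Function.iterate_mod_minimalPeriod_eq]
  rw [← Nat.card_eq_of_bijective _ e, Nat.card_fin]

/-- Turns arguments at a crossing into arithmetic with exponents below 4, and those along the
infinite region into exponents below its number of sides. -/
theorem Equiv.Perm.card_sameCycle_cases {α : Type*} [Finite α] (σ : Equiv.Perm α) (x : α) {m : ℕ}
    (h : Nat.card {y // σ.SameCycle x y} = m) :
    (σ ^ m) x = x ∧ (∀ i < m, ∀ j < m, (σ ^ i) x = (σ ^ j) x → i = j) ∧
      ∀ y, σ.SameCycle x y → ∃ i < m, (σ ^ i) x = y := by
  have hm : m = Function.minimalPeriod σ x := by rw [← h, Equiv.Perm.card_sameCycle]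
  have hpos : 0 < Function.minimalPeriod σ x :=
    Function.minimalPeriod_pos_of_mem_periodicPts
      (Function.Injective.mem_periodicPts σ.injective x)
  subst hm
  simp only [← Equiv.Perm.iterate_eq_pow]
  refine ⟨Function.iterate_minimalPeriod, fun i hi j hj hij =>
    (Function.iterate_eq_iterate_iff_of_lt_minimalPeriod hi hj).1 hij, fun y hy => ?_⟩
  obtain ⟨i, -, hi⟩ := hy.exists_pow_eq'
  refine ⟨i % _, Nat.mod_lt _ hpos, ?_⟩
  rw [Function.iterate_mod_minimalPeriod_eq, Equiv.Perm.iterate_eq_pow, hi]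

/-! ### Darts, corners and the faces of the dual map. -/

namespace CellMap

variable {δ : Type*} (M : CellMap δ)

instance [Finite δ] : Finite M.Vertex := inferInstanceAs (Finite (Quotient _))
instance [Finite δ] : Finite M.Edge := inferInstanceAs (Finite (Quotient _))
instance [Finite δ] : Finite M.Face := inferInstanceAs (Finite (Quotient _))

theorem vertex_eq_iff {d d' : δ} : M.vertex d = M.vertex d' ↔ M.rot.SameCycle d d' :=
  Quotient.eq (r := Equiv.Perm.SameCycle.setoid M.rot)

theorem face_eq_iff {d d' : δ} : M.face d = M.face d' ↔ M.turn.SameCycle d d' :=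
  Quotient.eq (r := Equiv.Perm.SameCycle.setoid M.turn)

theorem vertex_surjective : Function.Surjective M.vertex := Quotient.mk_surjective
theorem edge_surjective : Function.Surjective M.edge := Quotient.mk_surjective
theorem face_surjective : Function.Surjective M.face := Quotient.mk_surjective

theorem edge_flip (d : δ) : M.edge (M.flip d) = M.edge d :=
  Quotient.sound (s := Equiv.Perm.SameCycle.setoid M.flip) ⟨-1, by simp⟩

theorem edge_eq_iff {d d' : δ} : M.edge d = M.edge d' ↔ d' = d ∨ d' = M.flip d := by
  refine ⟨M.eq_or_eq_flip, ?_⟩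
  rintro (rfl | rfl)
  · rfl
  · exact (M.edge_flip d).symm

theorem vertex_rot (d : δ) : M.vertex (M.rot d) = M.vertex d :=
  M.vertex_eq_iff.2 ⟨-1, by simp⟩

theorem vertex_rot_pow (k : ℕ) (d : δ) : M.vertex ((M.rot ^ k) d) = M.vertex d :=
  M.vertex_eq_iff.2 ⟨-(k : ℤ), by simp⟩

theorem face_turn_pow (k : ℕ) (d : δ) : M.face ((M.turn ^ k) d) = M.face d :=
  M.face_eq_iff.2 ⟨-(k : ℤ), by simp⟩

theorem turn_flip_rot (d : δ) : M.turn (M.flip (M.rot d)) = d := by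
  simp [turn, M.flip_flip]

theorem rot_turn (d : δ) : M.rot (M.turn d) = M.flip d := by
  simp [turn]

/-- The sector between two consecutive darts is left of the first and right of the second. So `d`
also names the corner between `d` and `M.rot d`. -/
theorem face_flip_rot (d : δ) : M.face (M.flip (M.rot d)) = M.face d := by
  rw [← M.face_turn, M.turn_flip_rot]

section Cycles

variable {M}

theorem card_sameCycle_vertex {m : ℕ} {v : M.Vertex} (hv : M.valency v = m) {d : δ}
    (hd : M.vertex d = v) : Nat.card {y // M.rot.SameCycle d y} = m := by
  subst hd
  rw [← hv]
  exact Nat.card_congr (Equiv.subtypeEquivRight fun y => by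
    rw [← M.vertex_eq_iff, eq_comm])

theorem card_sameCycle_face {m : ℕ} {f : M.Face} (hf : M.sides f = m) {d : δ}
    (hd : M.face d = f) : Nat.card {y // M.turn.SameCycle d y} = m := by
  subst hd
  rw [← hf]
  exact Nat.card_congr (Equiv.subtypeEquivRight fun y => by
    rw [← M.face_eq_iff, eq_comm])

end Cycles

/-- The faces of the dual are the vertices. -/
theorem dual_face_eq_iff {d d' : δ} :
    M.dual.face d = M.dual.face d' ↔ M.vertex (M.flip d) = M.vertex (M.flip d') := by
  rw [face_eq_iff, vertex_eq_iff]
  -- The face permutation of the dual is `rot` conjugated by `flip`; hence the dual face of `d`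
  -- surrounds the end of `d`, not its start.
  have h : M.dual.turn = M.flip⁻¹ * M.rot * M.flip⁻¹⁻¹ := by
    simp [turn, dual, mul_assoc]
  rw [h, Equiv.Perm.sameCycle_conj]
  simp

noncomputable def dualFaceEquiv : M.dual.Face ≃ M.Vertex :=
  Equiv.ofBijective
    (Quotient.lift (fun d => M.vertex (M.flip d)) fun a b h =>
      M.dual_face_eq_iff.1 (Quotient.sound h)) (by
    constructor
    · intro a b
      obtain ⟨a, rfl⟩ := M.dual.face_surjective a
      obtain ⟨b, rfl⟩ := M.dual.face_surjective b
      exact M.dual_face_eq_iff.2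
    · intro v
      obtain ⟨d, rfl⟩ := M.vertex_surjective v
      refine ⟨M.dual.face (M.flip d), ?_⟩
      change M.vertex (M.flip (M.flip d)) = _
      rw [M.flip_flip])

theorem dualFaceEquiv_face (d : δ) : M.dualFaceEquiv (M.dual.face d) = M.vertex (M.flip d) := rfl

theorem dual_face_eq_iff' {d : δ} {f : M.dual.Face} :
    M.dual.face d = f ↔ M.vertex (M.flip d) = M.dualFaceEquiv f := by
  rw [← M.dualFaceEquiv.injective.eq_iff, dualFaceEquiv_face]

theorem dual_isCorner_iff {R : M.Face} {f : M.dual.Face} :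
    M.dual.IsCorner (M.dualVertex R) f ↔ M.IsCorner (M.dualFaceEquiv f) R := by
  constructor
  · rintro ⟨d, hd, hR⟩
    exact ⟨M.turn d, (M.face_turn d).trans hR, by
      rw [vertex_turn, M.dual_face_eq_iff'.1 hd]⟩
  · rintro ⟨d, hR, hd⟩
    refine ⟨M.flip (M.rot d), M.dual_face_eq_iff'.2 ?_, (M.face_flip_rot d).trans hR⟩
    rw [M.flip_flip, vertex_rot, hd]

end CellMap

/-! ### Homology modulo 2 and Euler's formula. -/

section LinearAlgebra

open Matrix Module

/-- If a short complex of incidence matrices is exact in the middle, then so is its transpose,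
and the Euler characteristic is the number of dimensions of the outer homology. -/
theorem Matrix.euler_and_dual_exact {K V E F : Type*} [Field K] [Fintype V] [Fintype E] [Fintype F]
    (A : Matrix V E K) (B : Matrix F E K) (hAB : A * Bᵀ = 0)
    (hex : ∀ c, A *ᵥ c = 0 → ∃ s, Bᵀ *ᵥ s = c)
    (hA : finrank K (LinearMap.ker Aᵀ.mulVecLin) = 1)
    (hB : finrank K (LinearMap.ker Bᵀ.mulVecLin) = 1) :
    Fintype.card V + Fintype.card F = Fintype.card E + 2 ∧
      ∀ c, B *ᵥ c = 0 → ∃ s, Aᵀ *ᵥ s = c := by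
  classical
  have rA := Aᵀ.mulVecLin.finrank_range_add_finrank_ker
  have rA' := A.mulVecLin.finrank_range_add_finrank_ker
  have rB := Bᵀ.mulVecLin.finrank_range_add_finrank_ker
  have rB' := B.mulVecLin.finrank_range_add_finrank_ker
  have tA : finrank K (LinearMap.range Aᵀ.mulVecLin) = finrank K (LinearMap.range A.mulVecLin) :=
    A.rank_transpose
  have tB : finrank K (LinearMap.range Bᵀ.mulVecLin) = finrank K (LinearMap.range B.mulVecLin) :=
    B.rank_transpose
  -- Exactness turns the nullity of `A` into the rank of `B`, so the number of edges is `(card V -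
  -- 1) + (card F - 1)`.
  have hker : LinearMap.ker A.mulVecLin = LinearMap.range Bᵀ.mulVecLin := by
    ext c
    constructor
    · intro h
      obtain ⟨s, hs⟩ := hex c h
      exact ⟨s, hs⟩
    · rintro ⟨s, rfl⟩
      rw [LinearMap.mem_ker, mulVecLin_apply, mulVecLin_apply, mulVec_mulVec, hAB, zero_mulVec]
  rw [hker] at rA'
  rw [finrank_fintype_fun_eq_card] at rA rA' rB rB'
  refine ⟨by omega, ?_⟩
  have hBA : B * Aᵀ = 0 := by
    have := congrArg Matrix.transpose hAB
    simpa using this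
  have hle : LinearMap.range Aᵀ.mulVecLin ≤ LinearMap.ker B.mulVecLin := by
    rintro _ ⟨s, rfl⟩
    rw [LinearMap.mem_ker, mulVecLin_apply, mulVecLin_apply, mulVec_mulVec, hBA, zero_mulVec]
  have heq := Submodule.eq_of_le_of_finrank_eq hle (by omega)
  intro c hc
  have : c ∈ LinearMap.ker B.mulVecLin := hc
  rw [← heq] at this
  obtain ⟨s, hs⟩ := this
  exact ⟨s, hs⟩

end LinearAlgebra

theorem SimpleGraph.Preconnected.map_eq_of_adj {V α : Type*} {G : SimpleGraph V}
    (hG : G.Preconnected) (s : V → α) (hs : ∀ u w, G.Adj u w → s u = s w) (u w : V) :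
    s u = s w := by
  obtain ⟨p⟩ := hG u w
  induction p with
  | nil => rfl
  | cons h _ ih => exact (hs _ _ h).trans ih

namespace CellMap

variable {δ : Type*} (M : CellMap δ)

theorem eq_of_flip_eq (hM : M.graph.Connected) {α : Type*} (s : M.Vertex → α)
    (hs : ∀ d, s (M.vertex d) = s (M.vertex (M.flip d))) (u w : M.Vertex) : s u = s w := by
  refine hM.preconnected.map_eq_of_adj s ?_ u w
  rintro _ _ ⟨-, _, d, -, rfl, rfl⟩
  exact hs d

/-- The dual of a connected decomposition is connected. -/
theorem eq_of_face_flip_eq (hM : M.graph.Connected) {α : Type*} (s : M.Face → α)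
    (hs : ∀ d, s (M.face d) = s (M.face (M.flip d))) (f g : M.Face) : s f = s g := by
  have hrot : ∀ d, s (M.face (M.rot d)) = s (M.face d) := fun d => by
    rw [hs, M.face_flip_rot]
  have hconst : ∀ (k : ℕ) d, s (M.face ((M.rot ^ k) d)) = s (M.face d) := by
    intro k
    induction k with
    | zero => simp
    | succ k ih => intro d; rw [pow_succ', Equiv.Perm.mul_apply, hrot, ih]
  have hz : ∀ (k : ℤ) d, s (M.face ((M.rot ^ k) d)) = s (M.face d) := by
    intro k d
    obtain ⟨k, rfl | rfl⟩ := k.eq_nat_or_neg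
    · exact_mod_cast hconst k d
    · rw [← hconst k ((M.rot ^ (-(k : ℤ))) d)]
      simp
  -- All faces around a vertex carry the same value, and `hs` says that these values agree at the
  -- two ends of an edge.
  let t : M.Vertex → α := Quotient.lift (fun d => s (M.face d)) (by
    rintro d _ ⟨k, rfl⟩
    exact (hz k d).symm)
  obtain ⟨d, rfl⟩ := M.face_surjective f
  obtain ⟨d', rfl⟩ := M.face_surjective g
  exact M.eq_of_flip_eq hM t (fun d => hs d) (M.vertex d) (M.vertex d')

section Incidence

open Classical in
/-- The incidence matrix modulo 2 of vertices and edges (a loop is counted twice). -/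
noncomputable def incidence : Matrix M.Vertex M.Edge (ZMod 2) := fun v =>
  Quotient.lift (fun d => (if M.vertex d = v then 1 else 0) +
    (if M.vertex (M.flip d) = v then 1 else 0)) (by
    intro a b h
    rcases M.eq_or_eq_flip (d := a) (d' := b) (Quotient.sound h) with rfl | rfl
    · rfl
    · rw [M.flip_flip, add_comm])

open Classical in
theorem incidence_edge (v : M.Vertex) (d : δ) : M.incidence v (M.edge d) =
    (if M.vertex d = v then 1 else 0) + (if M.vertex (M.flip d) = v then 1 else 0) := rfl

/-- The incidence matrix modulo 2 of faces and edges. -/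
noncomputable def faceIncidence : Matrix M.Face M.Edge (ZMod 2) := M.dual.incidence

open Classical in
theorem faceIncidence_edge (f : M.Face) (d : δ) : M.faceIncidence f (M.edge d) =
    (if M.face d = f then 1 else 0) + (if M.face (M.flip d) = f then 1 else 0) := rfl

open Matrix

theorem transpose_incidence_mulVec [Fintype M.Vertex] (s : M.Vertex → ZMod 2) (d : δ) :
    (M.incidenceᵀ *ᵥ s) (M.edge d) = s (M.vertex d) + s (M.vertex (M.flip d)) := by
  classical
  simp [Matrix.mulVec, dotProduct, incidence_edge, add_mul, Finset.sum_add_distrib]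

theorem sum_darts [Fintype δ] [Fintype M.Edge] (g : δ → ZMod 2) (h : M.Edge → ZMod 2)
    (hg : ∀ d, h (M.edge d) = g d + g (M.flip d)) : ∑ e, h e = ∑ d, g d := by
  classical
  rw [← Finset.sum_fiberwise (s := Finset.univ) (g := M.edge) (f := g)]
  refine Finset.sum_congr rfl fun e _ => ?_
  obtain ⟨d, rfl⟩ := M.edge_surjective e
  have : (Finset.univ.filter fun x => M.edge x = M.edge d) = {d, M.flip d} := by
    ext x
    simp [eq_comm (b := M.edge d), M.edge_eq_iff]
  rw [this, Finset.sum_pair (M.flip_ne d).symm, hg]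

open Classical in
theorem incidence_mulVec [Fintype δ] [Fintype M.Edge] (c : M.Edge → ZMod 2) (v : M.Vertex) :
    (M.incidence *ᵥ c) v = ∑ d, if M.vertex d = v then c (M.edge d) else 0 := by
  refine M.sum_darts _ _ fun d => ?_
  simp [incidence_edge, M.edge_flip, add_mul]

/-- The kernel of the coboundary consists of the functions constant along edges, here the constants.
-/
theorem finrank_ker_transpose_incidence [Finite δ] [Fintype M.Vertex] (hM : M.graph.Connected) :
    Module.finrank (ZMod 2) (LinearMap.ker M.incidenceᵀ.mulVecLin) = 1 := by
  obtain ⟨v₀⟩ := hM.nonempty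
  have : LinearMap.ker M.incidenceᵀ.mulVecLin = Submodule.span (ZMod 2) {1} := by
    ext s
    rw [Submodule.mem_span_singleton, LinearMap.mem_ker, Matrix.mulVecLin_apply]
    constructor
    · intro h
      refine ⟨s v₀, funext fun v => ?_⟩
      have := M.eq_of_flip_eq hM s (fun d => by
        have := congrFun h (M.edge d)
        rw [transpose_incidence_mulVec] at this
        exact CharTwo.add_eq_zero.1 this) v₀ v
      simpa using this
    · rintro ⟨a, rfl⟩
      ext e
      obtain ⟨d, rfl⟩ := M.edge_surjective e
      rw [transpose_incidence_mulVec]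
      simp [CharTwo.add_self_eq_zero]
  rw [this]
  refine finrank_span_singleton fun h => ?_
  simpa using congrFun h v₀

theorem dual_graph_connected (hM : M.graph.Connected) : M.dual.graph.Connected := by
  obtain ⟨v₀⟩ := hM.nonempty
  obtain ⟨d₀, -⟩ := M.vertex_surjective v₀
  have : Nonempty M.dual.Vertex := ⟨M.dual.vertex d₀⟩
  refine ⟨fun u w => ?_⟩
  have h := M.eq_of_face_flip_eq hM (fun f => M.dual.graph.Reachable (M.dual.vertex d₀) f)
    (fun d => by
      by_cases h : M.dual.vertex d = M.dual.vertex (M.flip d)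
      · exact congrArg _ h
      · have hadj : M.dual.graph.Adj (M.dual.vertex d) (M.dual.vertex (M.flip d)) :=
          ⟨h, _, d, rfl, rfl, rfl⟩
        exact propext ⟨fun k => k.trans hadj.reachable, fun k => k.trans hadj.symm.reachable⟩)
  have h' : ∀ u, M.dual.graph.Reachable (M.dual.vertex d₀) u := fun u => by
    have := h (M.face d₀) u
    exact this.mp (SimpleGraph.Reachable.refl _)
  exact (h' u).symm.trans (h' w)

/-- Each sector at a vertex is counted twice, once from each dart bounding it: shifting by `rot`
turns the sum over right sides into the sum over left sides. -/
theorem incidence_mul_dual [Fintype M.Edge] [Finite δ] :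
    M.incidence * M.faceIncidenceᵀ = 0 := by
  classical
  have := Fintype.ofFinite δ
  have := Fintype.ofFinite M.Face
  let _ : Fintype M.dual.Vertex := ‹Fintype M.Face›
  have key : ∀ s : M.Face → ZMod 2,
      M.incidence *ᵥ (M.faceIncidenceᵀ *ᵥ s) = 0 := by
    intro s
    ext v
    rw [incidence_mulVec]
    have h : ∀ d, (M.faceIncidenceᵀ *ᵥ s) (M.edge d) =
        s (M.face d) + s (M.face (M.flip d)) := fun d => M.dual.transpose_incidence_mulVec s d
    simp only [h]
    have h2 : (∑ d, if M.vertex d = v then s (M.face (M.flip d)) else 0) =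
        ∑ d, if M.vertex d = v then s (M.face d) else 0 := by
      rw [← Equiv.sum_comp M.rot]
      simp only [M.vertex_rot, M.face_flip_rot]
    have h3 : ∀ d, (if M.vertex d = v then s (M.face d) + s (M.face (M.flip d)) else 0) =
        (if M.vertex d = v then s (M.face d) else 0) +
          (if M.vertex d = v then s (M.face (M.flip d)) else 0) := fun d => by
      split_ifs <;> simp
    simp only [h3, Finset.sum_add_distrib, h2, CharTwo.add_self_eq_zero, Pi.zero_apply]
  ext v f
  have := congrFun (key (Pi.single f 1)) v
  rw [Matrix.mulVec_mulVec] at this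
  simpa using this

theorem exists_of_incidence_mulVec_eq_zero [Finite δ] [Fintype M.Edge] [Fintype M.Face]
    (hM : M.IsPlanar) (c : M.Edge → ZMod 2) (hc : M.incidence *ᵥ c = 0) :
    ∃ s : M.Face → ZMod 2, M.faceIncidenceᵀ *ᵥ s = c := by
  classical
  have := Fintype.ofFinite δ
  obtain ⟨S, hS⟩ := hM {e | c e = 1} (fun v => by
    have h := congrFun hc v
    rw [incidence_mulVec] at h
    rw [← ZMod.natCast_eq_zero_iff_even, Nat.card_eq_fintype_card, Fintype.card_subtype,
      Finset.card_filter]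
    refine Eq.trans ?_ h
    push_cast
    refine Finset.sum_congr rfl fun d _ => ?_
    have : c (M.edge d) = 0 ∨ c (M.edge d) = 1 := by
      generalize c (M.edge d) = x
      revert x
      decide
    rcases this with h | h <;> simp [h])
  refine ⟨fun f => if f ∈ S then 1 else 0, funext fun e => ?_⟩
  obtain ⟨d, rfl⟩ := M.edge_surjective e
  let _ : Fintype M.dual.Vertex := ‹Fintype M.Face›
  refine (M.dual.transpose_incidence_mulVec _ d).trans ?_
  change (if M.face d ∈ S then (1 : ZMod 2) else 0) + (if M.face (M.flip d) ∈ S then 1 else 0) = _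
  have h1 : c (M.edge d) = 1 ↔ Xor (M.face d ∈ S) (M.face (M.flip d) ∈ S) := hS d
  clear hS
  have h2 : c (M.edge d) = 0 ∨ c (M.edge d) = 1 := by
    generalize c (M.edge d) = x
    revert x
    decide
  have h3 : (1 : ZMod 2) + 1 = 0 := rfl
  rcases h2 with h2 | h2 <;> by_cases h4 : M.face d ∈ S <;>
    by_cases h5 : M.face (M.flip d) ∈ S <;> simp_all [Xor]

end Incidence

-- The second part is the dual Jordan property: the edges crossed by a closed curve are those across
-- a 2-colouring of the vertices.
open Matrix in
theorem euler_and_dual_exact [Finite δ] [Fintype M.Edge] (hM : M.graph.Connected)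
    (hpl : M.IsPlanar) :
    Nat.card M.Vertex + Nat.card M.Face = Nat.card M.Edge + 2 ∧
      ∀ c : M.Edge → ZMod 2, M.faceIncidence *ᵥ c = 0 →
        ∃ s : M.Vertex → ZMod 2, ∀ d, c (M.edge d) = s (M.vertex d) + s (M.vertex (M.flip d)) := by
  have := Fintype.ofFinite M.Vertex
  have := Fintype.ofFinite M.Face
  let _ : Fintype M.dual.Vertex := ‹Fintype M.Face›
  let _ : Fintype M.dual.Edge := ‹Fintype M.Edge›
  obtain ⟨h1, h2⟩ := Matrix.euler_and_dual_exact M.incidence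
    M.faceIncidence M.incidence_mul_dual
    (M.exists_of_incidence_mulVec_eq_zero hpl) (M.finrank_ker_transpose_incidence hM)
    (M.dual.finrank_ker_transpose_incidence (M.dual_graph_connected hM))
  refine ⟨by simp only [Nat.card_eq_fintype_card]; exact h1, fun c hc => ?_⟩
  obtain ⟨s, rfl⟩ := h2 c hc
  exact ⟨s, fun d => M.transpose_incidence_mulVec s d⟩

end CellMap

theorem Set.ncard_pair_le {α : Type*} (a b : α) : ({a, b} : Set α).ncard ≤ 2 :=
  (Set.ncard_insert_le _ _).trans (by rw [Set.ncard_singleton])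

/-! ### Arcs about a vertex as chains modulo 2. -/

namespace CellMap

variable {δ : Type*} (M : CellMap δ)

open Classical in
/-- The sum modulo 2 of the `k` edges that follow the dart `d` in the cyclic order
about its starting vertex. -/
noncomputable def arcChain (d : δ) (k : ℕ) : M.Edge → ZMod 2 :=
  ∑ i ∈ Finset.range k, Pi.single (M.edge ((M.rot ^ (i + 1)) d)) 1

open Matrix

-- Every intermediate face is entered and left once, so only the two ends of the arc survive.
open Classical in
theorem faceIncidence_mulVec_arcChain [Fintype M.Edge] (d : δ) (k : ℕ) :
    M.faceIncidence *ᵥ M.arcChain d k =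
      Pi.single (M.face d) 1 + Pi.single (M.face ((M.rot ^ k) d)) 1 := by
  induction k with
  | zero =>
    ext f
    simp [arcChain, CharTwo.add_self_eq_zero]
  | succ k ih =>
    have h : M.arcChain d (k + 1) =
        M.arcChain d k + Pi.single (M.edge ((M.rot ^ (k + 1)) d)) 1 := by
      simp [arcChain, Finset.sum_range_succ]
    rw [h, mulVec_add, ih]
    ext f
    have h2 : M.face (M.flip ((M.rot ^ (k + 1)) d)) = M.face ((M.rot ^ k) d) := by
      rw [pow_succ', Equiv.Perm.mul_apply, face_flip_rot]
    simp only [Pi.add_apply, mulVec_single_one, Matrix.col_apply, faceIncidence_edge, h2,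
      Pi.single_apply, eq_comm (a := f)]
    linear_combination CharTwo.add_self_eq_zero (if M.face ((M.rot ^ k) d) = f then (1 : ZMod 2) else 0)

open Classical in
theorem arcChain_apply (d : δ) (k : ℕ) (e : M.Edge) : M.arcChain d k e =
    ∑ i ∈ Finset.range k, if M.edge ((M.rot ^ (i + 1)) d) = e then 1 else 0 := by
  simp [arcChain, Finset.sum_apply, Pi.single_apply, eq_comm (a := e)]

theorem arcChain_eq_zero {d y : δ} (k : ℕ) (h : M.vertex y ≠ M.vertex d)
    (h' : M.vertex (M.flip y) ≠ M.vertex d) : M.arcChain d k (M.edge y) = 0 := by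
  rw [arcChain_apply]
  refine Finset.sum_eq_zero fun i _ => if_neg fun hi => ?_
  have := M.vertex_rot_pow (i + 1) d
  rcases M.eq_or_eq_flip hi with rfl | rfl
  · exact h this
  · rw [M.flip_flip] at h'
    exact h' this

end CellMap

/-! ### Consequences of 3-connectedness and minimality. -/

namespace DoodleDiagram

variable {δ : Type*} (D : DoodleDiagram δ)

section Crossing

theorem rot_pow_four [Finite δ] (d : δ) : (D.rot ^ 4) d = d :=
  (D.rot.card_sameCycle_cases d (CellMap.card_sameCycle_vertex (D.four_valent _) rfl)).1

theorem rot_pow_inj [Finite δ] {d : δ} {i j : ℕ} (hi : i < 4) (hj : j < 4)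
    (h : (D.rot ^ i) d = (D.rot ^ j) d) : i = j :=
  (D.rot.card_sameCycle_cases d
    (CellMap.card_sameCycle_vertex (D.four_valent _) rfl)).2.1 i hi j hj h

theorem exists_rot_pow [Finite δ] {d y : δ} (h : D.vertex d = D.vertex y) :
    ∃ i < 4, (D.rot ^ i) d = y :=
  (D.rot.card_sameCycle_cases d (CellMap.card_sameCycle_vertex (D.four_valent _) rfl)).2.2 y
    (D.vertex_eq_iff.1 h)

end Crossing

section Prime

variable {D} (hprime : D.IsPrime)
include hprime

/-- The form in which 3-connectedness is used throughout. -/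
theorem eq_of_flip_eq_off {S : Set D.Crossing} (hS : S.ncard < 3) {α : Type*} (s : D.Crossing → α)
    (hs : ∀ d, D.vertex d ∉ S → D.vertex (D.flip d) ∉ S →
      s (D.vertex d) = s (D.vertex (D.flip d)))
    {u w : D.Crossing} (hu : u ∉ S) (hw : w ∉ S) : s u = s w := by
  refine (hprime.2 S hS).preconnected.map_eq_of_adj (fun x => s x) ?_ ⟨u, hu⟩ ⟨w, hw⟩
  rintro ⟨_, h1⟩ ⟨_, h2⟩ ⟨-, _, d, -, rfl, rfl⟩
  exact hs d h1 h2

variable [Finite δ]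

/-- Otherwise removing `a` and `b` would cut `v` off from a fourth crossing. -/
theorem exists_dart_avoiding (v a b : D.Crossing) :
    ∃ y, D.vertex y = v ∧ D.vertex (D.flip y) ≠ v ∧ D.vertex (D.flip y) ≠ a ∧
      D.vertex (D.flip y) ≠ b := by
  by_contra! hcon
  have hu : ∃ u, u ∉ ({v, a, b} : Set D.Crossing) := by
    by_contra! h
    have h1 : (Set.univ : Set D.Crossing).ncard ≤ ({v, a, b} : Set D.Crossing).ncard :=
      Set.ncard_le_ncard (fun x _ => h x) (Set.toFinite _)
    rw [Set.ncard_univ] at h1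
    have h2 : ({v, a, b} : Set D.Crossing).ncard ≤ 3 := by
      refine (Set.ncard_insert_le _ _).trans ?_
      exact Nat.succ_le_succ (Set.ncard_pair_le _ _)
    have : 3 < Nat.card D.Crossing := hprime.1
    omega
  obtain ⟨u, hu⟩ := hu
  simp only [Set.mem_insert_iff, Set.mem_singleton_iff, not_or] at hu
  -- `a` or `b` may equal `v`, which has to stay.
  have hS : (({a, b} : Set D.Crossing) \ {v}).ncard < 3 :=
    (Set.ncard_le_ncard Set.sdiff_subset (Set.toFinite _)).trans_lt
      (Nat.lt_succ_of_le (Set.ncard_pair_le _ _))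
  have key := eq_of_flip_eq_off hprime hS (fun x => x = v) (fun d h1 h2 => by
    have aux : ∀ d, D.vertex (D.flip d) ∉ ({a, b} : Set D.Crossing) \ {v} → D.vertex d = v →
        D.vertex (D.flip d) = v := by
      intro d h2 hd
      by_contra h3
      have := hcon d hd h3
      simp only [Set.mem_sdiff, Set.mem_insert_iff, Set.mem_singleton_iff] at h2
      grind
    refine propext ⟨aux d h2, fun h => ?_⟩
    have := aux (D.flip d) (by rwa [D.flip_flip]) h
    rwa [D.flip_flip] at this) (u := u) (w := v) (by simp [hu]) (by simp)
  exact hu.1 (key.mpr rfl)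

/-- A loop takes up two of the four ends at its crossing, so the far ends of the other two would
isolate the crossing. -/
theorem vertex_flip_ne (d : δ) : D.vertex (D.flip d) ≠ D.vertex d := by
  intro h
  obtain ⟨i, hi, hid⟩ := D.exists_rot_pow h.symm
  have hi0 : i ≠ 0 := by
    rintro rfl
    exact D.flip_ne d hid.symm
  obtain ⟨j, -, k, -, hjk⟩ : ∃ j < 4, ∃ k < 4, ∀ l < 4, l = 0 ∨ l = i ∨ l = j ∨ l = k := by
    clear hid
    revert i
    decide
  obtain ⟨y, hy, h1, h2, h3⟩ := exists_dart_avoiding hprime (D.vertex d)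
    (D.vertex (D.flip ((D.rot ^ j) d))) (D.vertex (D.flip ((D.rot ^ k) d)))
  obtain ⟨l, hl, rfl⟩ := D.exists_rot_pow hy.symm
  rcases hjk l hl with rfl | rfl | rfl | rfl
  · exact h1 h
  · rw [hid, D.flip_flip] at h1
    exact h1 rfl
  · exact h2 rfl
  · exact h3 rfl

theorem eq_of_vertex_edge {x y : δ} (hv : D.vertex x = D.vertex y) (he : D.edge x = D.edge y) :
    x = y := by
  rcases D.eq_or_eq_flip he with rfl | rfl
  · rfl
  · exact (vertex_flip_ne hprime x hv.symm).elim

/-- Only one end at `v` would remain; removing `w` and the crossing it leads to would isolate `v`.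
-/
theorem not_three_parallel {x y z : δ} {v w : D.Crossing} (hx : D.vertex x = v)
    (hy : D.vertex y = v) (hz : D.vertex z = v) (hx' : D.vertex (D.flip x) = w)
    (hy' : D.vertex (D.flip y) = w) (hz' : D.vertex (D.flip z) = w) :
    x = y ∨ x = z ∨ y = z := by
  by_contra! hne
  obtain ⟨i, hi, rfl⟩ := D.exists_rot_pow (hx.trans hy.symm)
  obtain ⟨j, hj, rfl⟩ := D.exists_rot_pow (hx.trans hz.symm)
  have hi0 : i ≠ 0 := by rintro rfl; exact hne.1 rfl
  have hj0 : j ≠ 0 := by rintro rfl; exact hne.2.1 rfl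
  have hij : i ≠ j := by rintro rfl; exact hne.2.2 rfl
  obtain ⟨k, -, hk⟩ : ∃ k < 4, ∀ l < 4, l = 0 ∨ l = i ∨ l = j ∨ l = k := by
    clear hne hy hz hy' hz'
    interval_cases i <;> interval_cases j <;> first | omega | decide
  obtain ⟨y, h0, h1, h2, h3⟩ := exists_dart_avoiding hprime v w
    (D.vertex (D.flip ((D.rot ^ k) x)))
  obtain ⟨l, hl, rfl⟩ := D.exists_rot_pow (hx.trans h0.symm)
  rcases hk l hl with rfl | rfl | rfl | rfl
  · exact h2 hx'
  · exact h2 hy'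
  · exact h2 hz'
  · exact h3 rfl

/-- In a prime minimal diagram two crossings are joined by at most one edge. -/
theorem eq_of_parallel (hmin : D.IsMinimal) {x y : δ} (h : D.vertex x = D.vertex y)
    (h' : D.vertex (D.flip x) = D.vertex (D.flip y)) : x = y := by
  by_contra hne
  obtain ⟨v, hv⟩ : ∃ v, v = D.vertex x := ⟨_, rfl⟩
  obtain ⟨w, hw⟩ : ∃ w, w = D.vertex (D.flip x) := ⟨_, rfl⟩
  have hvw : v ≠ w := by
    rw [hv, hw]; exact (vertex_flip_ne hprime x).symm
  rw [← hv] at h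
  rw [← hw] at h'
  have hedge : ∀ z, D.edge z ∈ ({D.edge x, D.edge y} : Set D.Edge) ↔
      z = x ∨ z = D.flip x ∨ z = y ∨ z = D.flip y := by
    intro z
    simp only [Set.mem_insert_iff, Set.mem_singleton_iff, eq_comm (a := D.edge z),
      D.edge_eq_iff, or_assoc]
  -- The two edges form a closed curve, and `T` is the set of regions on one side of it.
  obtain ⟨T, hT⟩ := D.planar {D.edge x, D.edge y} (fun u => by
    change Even (Nat.card ({d | D.vertex d = u ∧ D.edge d ∈ ({D.edge x, D.edge y} :
      Set D.Edge)} : Set δ))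
    rw [Nat.card_coe_set_eq]
    simp only [hedge]
    by_cases huv : u = v
    · subst huv
      have : {d | D.vertex d = u ∧ (d = x ∨ d = D.flip x ∨ d = y ∨ d = D.flip y)} = {x, y} := by
        ext z
        simp only [Set.mem_ofPred_eq, Set.mem_insert_iff, Set.mem_singleton_iff]
        grind
      rw [this, Set.ncard_pair hne]
      decide
    by_cases huw : u = w
    · subst huw
      have : {d | D.vertex d = u ∧ (d = x ∨ d = D.flip x ∨ d = y ∨ d = D.flip y)} =
          {D.flip x, D.flip y} := by
        ext z
        simp only [Set.mem_ofPred_eq, Set.mem_insert_iff, Set.mem_singleton_iff]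
        grind
      rw [this, Set.ncard_pair (fun h => hne (D.flip.injective h))]
      decide
    have : {d | D.vertex d = u ∧ (d = x ∨ d = D.flip x ∨ d = y ∨ d = D.flip y)} = ∅ := by
      ext z
      simp only [Set.mem_ofPred_eq, Set.mem_empty_iff_false, iff_false]
      grind
    rw [this, Set.ncard_empty]
    decide)
  simp only [hedge] at hT
  have hoff : ∀ d, D.vertex d ∉ ({v, w} : Set D.Crossing) →
      (D.face d ∈ T ↔ D.face (D.flip d) ∈ T) := by
    intro d hd
    simp only [Set.mem_insert_iff, Set.mem_singleton_iff] at hd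
    have h1 : ¬ (d = x ∨ d = D.flip x ∨ d = y ∨ d = D.flip y) := by grind
    have := mt (hT d).2 h1
    unfold Xor at this
    tauto
  have hrot : ∀ (k : ℕ) (d : δ), D.vertex d ∉ ({v, w} : Set D.Crossing) →
      (D.face ((D.rot ^ k) d) ∈ T ↔ D.face d ∈ T) := by
    intro k d hd
    induction k with
    | zero => simp
    | succ k ih =>
      rw [hoff _ (by rwa [D.vertex_rot_pow]), pow_succ', Equiv.Perm.mul_apply, D.face_flip_rot, ih]
  have hs : ∀ d, D.vertex d ∉ ({v, w} : Set D.Crossing) →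
      ((∀ z, D.vertex z = D.vertex d → D.face z ∈ T) ↔ D.face d ∈ T) := by
    intro d hd
    refine ⟨fun h => h d rfl, fun h z hz => ?_⟩
    obtain ⟨i, -, rfl⟩ := D.exists_rot_pow hz.symm
    exact (hrot i d hd).2 h
  -- Connectedness without `v` and `w` puts all other crossings on the same side of the curve.
  have hconst : ∀ d, D.vertex d ∉ ({v, w} : Set D.Crossing) →
      ∀ d', D.vertex d' ∉ ({v, w} : Set D.Crossing) → (D.face d ∈ T ↔ D.face d' ∈ T) := by
    intro d hd d' hd'
    have := eq_of_flip_eq_off hprime (S := {v, w}) (Nat.lt_succ_of_le (Set.ncard_pair_le _ _))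
      (fun u => ∀ z, D.vertex z = u → D.face z ∈ T)
      (fun z h1 h2 => propext (by rw [hs z h1, hs _ h2, hoff z h1])) hd hd'
    rw [← hs d hd, ← hs d' hd']
    exact iff_of_eq this
  obtain ⟨z₀, -, h1, h2, -⟩ := exists_dart_avoiding hprime v w w
  have hz₀ : D.vertex (D.flip z₀) ∉ ({v, w} : Set D.Crossing) := by simp [h1, h2]
  -- The region of `x'` lies on the other side, so its corners can only be `v` and `w`.
  obtain ⟨x', hx'⟩ : ∃ x', ¬ (D.face x' ∈ T ↔ D.face (D.flip z₀) ∈ T) := by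
    by_contra! hall
    have := (hT x).1 (Or.inl rfl)
    rw [hall x, hall (D.flip x)] at this
    unfold Xor at this
    tauto
  have hin : ∀ d, D.face d = D.face x' → D.edge d ∈ ({D.edge x, D.edge y} : Set D.Edge) := by
    intro d hd
    have g1 : ∀ d, D.face d = D.face x' → D.vertex d = v ∨ D.vertex d = w := by
      intro d hd
      by_contra hcon
      have := hconst d (by simpa using hcon) _ hz₀
      rw [hd] at this
      exact hx' this
    have g2 := g1 _ ((D.face_turn d).trans hd)
    rw [D.vertex_turn] at g2
    have g3 := vertex_flip_ne hprime d
    have g4 : (D.vertex d = v ∧ D.vertex (D.flip d) = w) ∨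
        (D.vertex (D.flip d) = v ∧ D.vertex (D.flip (D.flip d)) = w) := by
      rw [D.flip_flip]
      rcases g1 d hd with g | g <;> rcases g2 with g' | g' <;> grind
    rcases g4 with ⟨g5, g6⟩ | ⟨g5, g6⟩
    · rcases not_three_parallel hprime hv.symm h.symm g5 hw.symm h'.symm g6 with g | rfl | rfl
      · exact (hne g).elim
      · simp
      · simp
    · rw [← D.edge_flip d]
      rcases not_three_parallel hprime hv.symm h.symm g5 hw.symm h'.symm g6 with g | g | g
      · exact (hne g).elim
      · simp [g]
      · simp [g]
  -- Each edge of this region belongs to the curve and so separates different regions; the region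
  -- therefore has at most two sides.
  have hinj : Set.InjOn D.edge {d | D.face d = D.face x'} := by
    intro d hd d' hd' hdd
    rcases D.eq_or_eq_flip hdd with rfl | rfl
    · rfl
    · have := (hT d).1 ((hedge d).1 (hin d hd))
      rw [show D.face d = D.face x' from hd,
        show D.face (D.flip d) = D.face x' from hd'] at this
      unfold Xor at this
      tauto
  have hcard : ({d | D.face d = D.face x'} : Set δ).ncard ≤ 2 := by
    rw [← hinj.ncard_image]
    refine (Set.ncard_le_ncard ?_ (Set.toFinite _)).trans (Set.ncard_pair_le (D.edge x) (D.edge y))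
    rintro _ ⟨d, hd, rfl⟩
    exact hin d hd
  have := hmin (D.face x')
  rw [← Nat.card_coe_set_eq] at hcard
  exact absurd (this.trans hcard) (by decide)

open Matrix

/-- Without loops the four darts at a crossing belong to four edges, so no coefficients cancel. -/
theorem arcChain_rot_pow (d : δ) {j k : ℕ} (hj : j < 4) (hk : k ≤ 4) :
    D.arcChain d k (D.edge ((D.rot ^ (j + 1)) d)) = if j < k then 1 else 0 := by
  classical
  rw [CellMap.arcChain_apply]
  have h : ∀ i ∈ Finset.range k, (if D.edge ((D.rot ^ (i + 1)) d) = D.edge ((D.rot ^ (j + 1)) d)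
      then (1 : ZMod 2) else 0) = if j = i then 1 else 0 := by
    intro i hi
    rw [Finset.mem_range] at hi
    congr 1
    refine propext ⟨fun h => ?_, fun h => by rw [h]⟩
    have h := eq_of_vertex_edge hprime (by rw [D.vertex_rot_pow, D.vertex_rot_pow]) h
    rw [pow_succ', pow_succ', Equiv.Perm.mul_apply, Equiv.Perm.mul_apply] at h
    exact (D.rot_pow_inj (hi.trans_le hk) hj (D.rot.injective h)).symm
  rw [Finset.sum_congr rfl h]
  simp

/-- A region of a prime diagram touches a crossing at most once. -/
theorem eq_of_vertex_face {d d' : δ} (hv : D.vertex d = D.vertex d')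
    (hf : D.face d = D.face d') : d = d' := by
  classical
  have := Fintype.ofFinite D.Edge
  obtain ⟨k, hk, rfl⟩ := D.exists_rot_pow hv
  by_contra hne
  have hk0 : k ≠ 0 := by rintro rfl; exact hne rfl
  -- An arc from a region back to itself is a closed curve.
  obtain ⟨s, hs⟩ := (D.euler_and_dual_exact D.connected D.planar).2 (D.arcChain d k) (by
    rw [CellMap.faceIncidence_mulVec_arcChain, ← hf]
    ext f
    exact CharTwo.add_self_eq_zero _)
  obtain ⟨z₀, -, hz₀, -⟩ := exists_dart_avoiding hprime (D.vertex d) (D.vertex d) (D.vertex d)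
  have hoff : ∀ u, u ≠ D.vertex d → s u = s (D.vertex (D.flip z₀)) := by
    intro u hu
    refine eq_of_flip_eq_off hprime (S := {D.vertex d}) (by simp) s (fun z h1 h2 => ?_)
      (by simpa using hu) (by simpa using hz₀)
    have := hs z
    rw [D.arcChain_eq_zero k (by simpa using h1) (by simpa using h2)] at this
    exact CharTwo.add_eq_zero.1 this.symm
  -- All neighbours have one colour, so all four edges get the same coefficient; yet the first is
  -- crossed and the last is not, as `0 < k < 4`.
  have key : ∀ j < 4, (if j < k then (1 : ZMod 2) else 0) =
      s (D.vertex d) + s (D.vertex (D.flip z₀)) := by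
    intro j hj
    rw [← arcChain_rot_pow hprime d hj hk.le, hs, D.vertex_rot_pow, hoff (D.vertex (D.flip _))]
    conv_rhs => rw [← D.vertex_rot_pow (j + 1) d]
    exact vertex_flip_ne hprime _
  have h1 := (key 0 (by decide)).trans (key 3 (by decide)).symm
  rw [if_pos (by omega), if_neg (by omega)] at h1
  exact one_ne_zero h1

/-- Two regions of a prime minimal diagram with two common crossings share an edge between them. -/
theorem exists_common_edge (hmin : D.IsMinimal) {f g : D.Region} {v w : D.Crossing} (hfg : f ≠ g)
    (hvw : v ≠ w) (hvf : D.IsCorner v f) (hvg : D.IsCorner v g) (hwf : D.IsCorner w f)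
    (hwg : D.IsCorner w g) : ∃ x, D.vertex x = v ∧ D.vertex (D.flip x) = w ∧
      ((D.face x = f ∧ D.face (D.flip x) = g) ∨ (D.face x = g ∧ D.face (D.flip x) = f)) := by
  classical
  have := Fintype.ofFinite D.Edge
  obtain ⟨d, hdf, hdv⟩ := hvf
  obtain ⟨d', hdg, hdv'⟩ := hvg
  obtain ⟨z', hzf, hzw⟩ := hwf
  obtain ⟨z, hzg, hzw'⟩ := hwg
  obtain ⟨k, hk, rfl⟩ := D.exists_rot_pow (hdv.trans hdv'.symm)
  obtain ⟨l, hl, rfl⟩ := D.exists_rot_pow (hzw'.trans hzw.symm)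
  have hk0 : k ≠ 0 := by rintro rfl; exact hfg (hdf.symm.trans hdg)
  -- The closed curve runs from `f` to `g` about `v` and back from `g` to `f` about `w`.
  obtain ⟨s, hs⟩ := (D.euler_and_dual_exact D.connected D.planar).2
    (D.arcChain d k + D.arcChain z l) (by
    rw [mulVec_add, CellMap.faceIncidence_mulVec_arcChain, CellMap.faceIncidence_mulVec_arcChain,
      hdf, hdg, hzf, hzg, add_comm (Pi.single g 1)]
    ext f
    exact CharTwo.add_self_eq_zero (_ : ZMod 2))
  obtain ⟨z₀, -, hz₀v, hz₀w, -⟩ := exists_dart_avoiding hprime v w w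
  have hoff : ∀ u, u ≠ v → u ≠ w → s u = s (D.vertex (D.flip z₀)) := by
    intro u hu hu'
    refine eq_of_flip_eq_off hprime (S := {v, w}) (Nat.lt_succ_of_le (Set.ncard_pair_le _ _)) s
      (fun y h1 h2 => ?_) (by simp [hu, hu']) (by simp [hz₀v, hz₀w])
    simp only [Set.mem_insert_iff, Set.mem_singleton_iff, not_or] at h1 h2
    have := hs y
    rw [Pi.add_apply, D.arcChain_eq_zero k (by rw [hdv]; exact h1.1) (by rw [hdv]; exact h2.1),
      D.arcChain_eq_zero l (by rw [hzw']; exact h1.2) (by rw [hzw']; exact h2.2), add_zero] at this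
    exact CharTwo.add_eq_zero.1 this.symm
  -- Edges at `v` not leading to `w` have equal coefficients, so either the `k` crossed edges or the
  -- `4 - k` others all lead to `w`.
  have key : ∀ j < 4, D.vertex (D.flip ((D.rot ^ (j + 1)) d)) ≠ w →
      (if j < k then (1 : ZMod 2) else 0) = s v + s (D.vertex (D.flip z₀)) := by
    intro j hj hjw
    have hjv : D.vertex ((D.rot ^ (j + 1)) d) = v := by rw [D.vertex_rot_pow, hdv]
    have h := hs ((D.rot ^ (j + 1)) d)
    rw [Pi.add_apply, arcChain_rot_pow hprime d hj hk.le,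
      D.arcChain_eq_zero l (by rw [hjv, hzw']; exact hvw) (by rw [hzw']; exact hjw), add_zero,
      hoff _ (by rw [← hjv]; exact vertex_flip_ne hprime _) hjw, hjv] at h
    exact h
  -- As parallel edges are excluded, only `k = 1` and `k = 3` remain.
  have huniq : ∀ i < 3, D.vertex (D.flip ((D.rot ^ (i + 1)) d)) = w →
      D.vertex (D.flip ((D.rot ^ (i + 1 + 1)) d)) = w → False := by
    intro i hi h1 h2
    have h3 := eq_of_parallel hprime hmin (by rw [D.vertex_rot_pow, D.vertex_rot_pow])
      (h1.trans h2.symm)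
    rw [pow_succ', pow_succ' D.rot (i + 1), Equiv.Perm.mul_apply, Equiv.Perm.mul_apply] at h3
    have := D.rot_pow_inj (by omega) (by omega) (D.rot.injective h3)
    omega
  by_cases h0 : s v + s (D.vertex (D.flip z₀)) = 0
  · have hw : ∀ j < k, D.vertex (D.flip ((D.rot ^ (j + 1)) d)) = w := by
      intro j hj
      by_contra hcon
      have := key j (hj.trans hk) hcon
      rw [h0, if_pos hj] at this
      exact one_ne_zero this
    have hk1 : k = 1 := by
      by_contra hk1
      exact huniq 0 (by decide) (hw 0 (by omega)) (hw 1 (by omega))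
    subst hk1
    refine ⟨(D.rot ^ 1) d, hdv', hw 0 (by decide), Or.inr ⟨hdg, ?_⟩⟩
    rw [pow_one, D.face_flip_rot, hdf]
  · have hw : ∀ j < 4, k ≤ j → D.vertex (D.flip ((D.rot ^ (j + 1)) d)) = w := by
      intro j hj hkj
      by_contra hcon
      have := key j hj hcon
      rw [if_neg (by omega)] at this
      exact h0 this.symm
    have hk3 : k = 3 := by
      by_contra hk3
      exact huniq 2 (by decide) (hw 2 (by decide) (by omega)) (hw 3 (by decide) (by omega))
    subst hk3
    have h4 := hw 3 (by decide) le_rfl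
    have h5 : D.face (D.flip ((D.rot ^ 4) d)) = g := by
      rw [pow_succ', Equiv.Perm.mul_apply, D.face_flip_rot, hdg]
    rw [D.rot_pow_four] at h4 h5
    exact ⟨d, hdv, h4, Or.inl ⟨hdf, h5⟩⟩

end Prime

end DoodleDiagram

/-! ### How regions meet one another. -/

namespace DoodleDiagram

variable {δ : Type*} {D : DoodleDiagram δ}

theorem isCorner_face (d : δ) : D.IsCorner (D.vertex d) (D.face d) := ⟨d, rfl, rfl⟩

theorem isCorner_face_flip (d : δ) : D.IsCorner (D.vertex d) (D.face (D.flip d)) :=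
  ⟨D.turn (D.flip d), D.face_turn _, by rw [D.vertex_turn, D.flip_flip]⟩

theorem isCorner_flip_face (d : δ) : D.IsCorner (D.vertex (D.flip d)) (D.face d) := by
  simpa only [D.flip_flip] using isCorner_face_flip (D := D) (D.flip d)

theorem rot_turn_flip (d : δ) : D.rot (D.turn (D.flip d)) = d := by
  rw [D.rot_turn, D.flip_flip]

theorem face_rot_turn (d : δ) : D.face (D.rot (D.turn d)) = D.face (D.flip d) := by
  rw [D.rot_turn]

section Prime

variable [Finite δ] (hprime : D.IsPrime)
include hprime

/-- Otherwise the region would have two corners at the start of `d`, one on either side of it. -/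
theorem face_flip_ne (d : δ) : D.face (D.flip d) ≠ D.face d := by
  intro h
  have h1 : D.turn (D.flip d) = d := eq_of_vertex_face hprime
    (by rw [D.vertex_turn, D.flip_flip]) (by rw [D.face_turn, h])
  have h2 := rot_turn_flip (D := D) d
  rw [h1] at h2
  have := D.rot_pow_inj (d := d) (i := 1) (j := 0) (by decide) (by decide) (by simpa using h2)
  omega

theorem edge_injOn_face (f : D.Region) : Set.InjOn D.edge {d | D.face d = f} := by
  intro d hd d' hd' h
  rcases D.eq_or_eq_flip h with rfl | rfl
  · rfl
  · exact (face_flip_ne hprime d (hd'.trans hd.symm)).elim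

theorem vertex_injOn_face (f : D.Region) : Set.InjOn D.vertex {d | D.face d = f} :=
  fun _ hd _ hd' h => eq_of_vertex_face hprime h (hd.trans hd'.symm)

/-- The corner at the start of `d` of the region on the right of `d` is the one before `d`. -/
theorem turn_flip_eq {d d' : δ} (hv : D.vertex d' = D.vertex d)
    (hf : D.face d' = D.face (D.flip d)) : D.rot d' = d := by
  rw [show d' = D.turn (D.flip d) from eq_of_vertex_face hprime
    (by rw [D.vertex_turn, D.flip_flip, hv]) (by rw [D.face_turn, hf]), rot_turn_flip]

/-- Say `d` runs from `a` to `b` and `d'` from `b` to `c`. The regions also share an edge from `a`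
to `c`. It is either `d`, making `d'` a loop, or a second common edge at `a`; then the two regions
fill the whole angle at `a`, against valency four. -/
theorem not_consecutive_common_edges (hmin : D.IsMinimal) {d d' : δ} (hne : d ≠ d')
    (hf : D.face d = D.face d') (hg : D.face (D.flip d) = D.face (D.flip d'))
    (hv : D.vertex d' = D.vertex (D.flip d)) : False := by
  have hfg := (face_flip_ne hprime d).symm
  have hne' : D.vertex (D.flip d') ≠ D.vertex d := by
    intro h
    have h1 : D.flip d' = d := eq_of_parallel hprime hmin h (by rw [D.flip_flip, hv])
    exact face_flip_ne hprime d' (by rw [h1, hf])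
  obtain ⟨x, hx, hx', ⟨h1, h2⟩ | ⟨h1, h2⟩⟩ := exists_common_edge hprime hmin hfg hne'.symm
    (isCorner_face d) (isCorner_face_flip d) (hf ▸ isCorner_flip_face d')
    (hg ▸ isCorner_face (D.flip d'))
  · obtain rfl := eq_of_vertex_face hprime hx h1
    exact vertex_flip_ne hprime d' (hx'.symm.trans hv.symm)
  · have h3 := turn_flip_eq hprime hx h1
    have h4 := turn_flip_eq hprime hx.symm h2.symm
    have := D.rot_pow_inj (d := d) (i := 2) (j := 0) (by decide) (by decide)
      (by simp [pow_two, h3, h4])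
    omega

/-- Two regions of a prime minimal diagram have at most one edge in common. -/
theorem eq_of_face_face_flip (hmin : D.IsMinimal) {d d' : δ} (hf : D.face d = D.face d')
    (hg : D.face (D.flip d) = D.face (D.flip d')) : d = d' := by
  by_contra hne
  have hne1 : D.vertex d ≠ D.vertex d' := fun h => hne (eq_of_vertex_face hprime h hf)
  -- The common edge between the two starting points must be `d` or the reverse of `d'`, so these
  -- edges are consecutive.
  obtain ⟨x, hx, hx', ⟨h1, h2⟩ | ⟨h1, h2⟩⟩ := exists_common_edge hprime hmin
    (face_flip_ne hprime d).symm hne1 (isCorner_face d) (isCorner_face_flip d)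
    (hf ▸ isCorner_face d') (hg ▸ isCorner_face_flip d')
  · obtain rfl := eq_of_vertex_face hprime hx h1
    exact not_consecutive_common_edges hprime hmin hne hf hg hx'.symm
  · obtain rfl := eq_of_vertex_face hprime hx' (h2.trans hf)
    rw [D.flip_flip] at hg
    exact not_consecutive_common_edges hprime hmin (Ne.symm hne) hf.symm
      (by rw [D.flip_flip, hg]) (by rw [D.flip_flip, hx])

/-- A region containing both ends of an edge lies on a side of it. -/
theorem face_eq_or_of_isCorner (hmin : D.IsMinimal) {R : D.Region} {d : δ}
    (h : D.IsCorner (D.vertex d) R) (h' : D.IsCorner (D.vertex (D.flip d)) R) :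
    D.face d = R ∨ D.face (D.flip d) = R := by
  by_contra! hcon
  obtain ⟨x, hx, hx', hR⟩ := exists_common_edge hprime hmin hcon.1
    (vertex_flip_ne hprime d).symm (isCorner_face d) h (isCorner_flip_face d) h'
  obtain rfl := eq_of_parallel hprime hmin hx hx'
  rcases hR with ⟨-, h⟩ | ⟨h, -⟩
  · exact hcon.2 h
  · exact hcon.1 h

/-- Of three consecutive neighbours of a crossing off `R`, one is off `R`. -/
theorem not_three_consecutive_corners (hmin : D.IsMinimal) {R : D.Region} {x : δ}
    (hv : ¬ D.IsCorner (D.vertex x) R) (h₀ : D.IsCorner (D.vertex (D.flip x)) R)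
    (h₁ : D.IsCorner (D.vertex (D.flip (D.rot x))) R)
    (h₂ : D.IsCorner (D.vertex (D.flip (D.rot (D.rot x)))) R) : False := by
  obtain ⟨y, hy⟩ : ∃ y, y = D.flip (D.rot x) := ⟨_, rfl⟩
  have hy' : D.flip y = D.rot x := by rw [hy, D.flip_flip]
  have hfy : D.face y = D.face x := by rw [hy, D.face_flip_rot]
  rw [← hy] at h₁
  have hRg : R ≠ D.face y := by
    rintro rfl
    exact hv (hfy ▸ isCorner_face x)
  have hRg' : R ≠ D.face (D.flip y) := by
    rintro rfl
    refine hv ?_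
    rw [hy', ← D.vertex_rot]
    exact isCorner_face _
  have hrot : ∀ d, D.rot d ≠ d := fun d hd => by
    have := D.rot_pow_inj (d := d) (i := 1) (j := 0) (by decide) (by decide) (by simpa using hd)
    omega
  have hne₁ : D.vertex y ≠ D.vertex (D.flip x) := by
    intro h
    rw [hy] at h
    exact hrot x (eq_of_parallel hprime hmin (D.vertex_rot x) h)
  have hne₂ : D.vertex y ≠ D.vertex (D.flip (D.rot (D.rot x))) := by
    intro h
    rw [hy] at h
    exact hrot _ (eq_of_parallel hprime hmin (D.vertex_rot (D.rot x)) h.symm)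
  -- `R` shares two crossings with each region beside the middle edge `y`, hence an edge at the
  -- start of `y` with each. The rotation there would close up after three steps.
  obtain ⟨y₁, hy₁, -, ⟨h3, h4⟩ | ⟨h3, h4⟩⟩ := exists_common_edge hprime hmin hRg hne₁ h₁
    (isCorner_face y) h₀ (hfy ▸ isCorner_flip_face x)
  · have h5 := turn_flip_eq hprime hy₁.symm h4.symm
    obtain ⟨y₂, hy₂, -, ⟨h6, h7⟩ | ⟨h6, h7⟩⟩ := exists_common_edge hprime hmin hRg' hne₂ h₁
      (isCorner_face_flip y) h₂ (by
        rw [hy', ← D.face_flip_rot (D.rot x)]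
        exact isCorner_face _)
    · obtain rfl := eq_of_vertex_face hprime (hy₁.trans hy₂.symm) (h3.trans h6.symm)
      exact face_flip_ne hprime y (h7.symm.trans h4)
    · have h8 := turn_flip_eq hprime hy₂ h6
      have h9 := turn_flip_eq hprime (hy₁.trans hy₂.symm) (h3.trans h7.symm)
      have := D.rot_pow_inj (d := y) (i := 3) (j := 0) (by decide) (by decide)
        (by simp [pow_succ, h5, h8, h9])
      omega
  · obtain rfl := eq_of_vertex_face hprime hy₁ h3
    exact hRg' h4.symm

/-- Any three of the four neighbours are cyclically consecutive, so at most two lie on `R`. -/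
theorem exists_two_neighbours_off (hmin : D.IsMinimal) {R : D.Region} {x : δ}
    (hv : ¬ D.IsCorner (D.vertex x) R) : ∃ y z, D.vertex y = D.vertex x ∧
      D.vertex z = D.vertex x ∧ y ≠ z ∧ ¬ D.IsCorner (D.vertex (D.flip y)) R ∧
      ¬ D.IsCorner (D.vertex (D.flip z)) R := by
  have h : ∀ i, ¬ (D.IsCorner (D.vertex (D.flip ((D.rot ^ i) x))) R ∧
      D.IsCorner (D.vertex (D.flip ((D.rot ^ (i + 1)) x))) R ∧
      D.IsCorner (D.vertex (D.flip ((D.rot ^ (i + 2)) x))) R) := by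
    rintro i ⟨h0, h1, h2⟩
    simp only [pow_succ', Equiv.Perm.mul_apply] at h1 h2
    exact not_three_consecutive_corners hprime hmin (by rwa [D.vertex_rot_pow]) h0 h1 h2
  have h0 := h 0
  have h1 := h 1
  have h2 := h 2
  have h3 := h 3
  have h45 : (D.rot ^ 5) x = (D.rot ^ 1) x := by
    rw [show 5 = 1 + 4 from rfl, pow_add, Equiv.Perm.mul_apply, D.rot_pow_four]
  have h44 : (D.rot ^ 4) x = (D.rot ^ 0) x := D.rot_pow_four x
  simp only [Nat.reduceAdd, h44, h45] at h0 h1 h2 h3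
  have key : ∃ i < 4, ∃ j < 4, i ≠ j ∧ ¬ D.IsCorner (D.vertex (D.flip ((D.rot ^ i) x))) R ∧
      ¬ D.IsCorner (D.vertex (D.flip ((D.rot ^ j) x))) R := by
    by_contra! hcon
    have c01 := hcon 0 (by decide) 1 (by decide) (by decide)
    have c02 := hcon 0 (by decide) 2 (by decide) (by decide)
    have c03 := hcon 0 (by decide) 3 (by decide) (by decide)
    have c12 := hcon 1 (by decide) 2 (by decide) (by decide)
    have c13 := hcon 1 (by decide) 3 (by decide) (by decide)
    have c23 := hcon 2 (by decide) 3 (by decide) (by decide)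
    clear hcon h
    generalize D.IsCorner (D.vertex (D.flip ((D.rot ^ 0) x))) R = N₀ at *
    generalize D.IsCorner (D.vertex (D.flip ((D.rot ^ 1) x))) R = N₁ at *
    generalize D.IsCorner (D.vertex (D.flip ((D.rot ^ 2) x))) R = N₂ at *
    generalize D.IsCorner (D.vertex (D.flip ((D.rot ^ 3) x))) R = N₃ at *
    clear h44 h45 hv
    by_cases N₀ <;> by_cases N₁ <;> by_cases N₂ <;> by_cases N₃ <;> simp_all
  obtain ⟨i, hi, j, hj, hij, hi', hj'⟩ := key
  exact ⟨_, _, D.vertex_rot_pow i x, D.vertex_rot_pow j x,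
    fun h => hij (D.rot_pow_inj hi hj h), hi', hj'⟩

/-- Going round a crossing of `R`, one does not meet `R` again before a full turn. -/
theorem face_rot_pow_ne {R : D.Region} {y : δ} (hy : D.face y = R) {j : ℕ} (hj : j < 4)
    (hj0 : j ≠ 0) : D.face ((D.rot ^ j) y) ≠ R := by
  intro h
  have := eq_of_vertex_face hprime (D.vertex_rot_pow j y) (h.trans hy.symm)
  exact hj0 (D.rot_pow_inj (j := 0) hj (by decide) (by simpa using this))

omit hprime [Finite δ] in
theorem face_flip_rot_pow_succ (y : δ) (j : ℕ) :
    D.face (D.flip ((D.rot ^ (j + 1)) y)) = D.face ((D.rot ^ j) y) := by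
  rw [pow_succ', Equiv.Perm.mul_apply, D.face_flip_rot]

-- The region across the edge `y` is seen from both of its ends. This is how the boundary circle
-- passes from one corner of the infinite region to the next.
omit hprime in
theorem face_rot_pow_three (y : δ) : D.face ((D.rot ^ 3) y) = D.face ((D.rot ^ 1) (D.turn y)) := by
  rw [← face_flip_rot_pow_succ, D.rot_pow_four, pow_one, face_rot_turn]

/-- The two regions share an edge between the two crossings. It is `y`, whose far side has the
excluded exponent 3, or `D.rot y`, whose far side has exponent 1. -/
theorem boundary_face_aux (hmin : D.IsMinimal) {y y' : δ} {j j' : ℕ}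
    (hf : D.face y = D.face y') (hv : D.vertex y ≠ D.vertex y') (hj : j = 1 ∨ j = 2)
    (hj' : j' = 1 ∨ j' = 2) (h : D.face ((D.rot ^ j) y) = D.face ((D.rot ^ j') y')) :
    j = 1 ∧ D.vertex (D.flip (D.rot y)) = D.vertex y' := by
  have hne : D.face y ≠ D.face ((D.rot ^ j) y) :=
    (face_rot_pow_ne hprime rfl (by omega) (by omega)).symm
  obtain ⟨x, hx, hx', ⟨h1, h2⟩ | ⟨h1, h2⟩⟩ := exists_common_edge hprime hmin hne hv
    (isCorner_face y) ⟨_, rfl, D.vertex_rot_pow j y⟩ (hf ▸ isCorner_face y')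
    ⟨_, h.symm, D.vertex_rot_pow j' y'⟩
  · obtain rfl := eq_of_vertex_face hprime hx h1
    rw [← D.rot_pow_four x, face_flip_rot_pow_succ, D.rot_pow_four] at h2
    have h3 := eq_of_vertex_face hprime (by rw [D.vertex_rot_pow, D.vertex_rot_pow]) h2
    have := D.rot_pow_inj (by decide) (by omega) h3
    omega
  · obtain rfl := eq_of_vertex_face hprime (hx.trans (D.vertex_rot_pow j y).symm) h1
    obtain ⟨i, rfl⟩ : ∃ i, j = i + 1 := ⟨j - 1, by omega⟩
    rw [face_flip_rot_pow_succ] at h2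
    have hi : i = 0 := by
      by_contra hi
      exact face_rot_pow_ne hprime rfl (by omega) hi h2
    subst hi
    exact ⟨rfl, by simpa using hx'⟩

/-- For different crossings, `boundary_face_aux` in both directions yields one edge leaving each of
them with the region of `y` on its right, hence with that region on both sides. -/
theorem boundary_face_inj (hmin : D.IsMinimal) {y y' : δ} {j j' : ℕ}
    (hf : D.face y = D.face y') (hj : j = 1 ∨ j = 2) (hj' : j' = 1 ∨ j' = 2)
    (h : D.face ((D.rot ^ j) y) = D.face ((D.rot ^ j') y')) : y = y' ∧ j = j' := by
  by_cases hv : D.vertex y = D.vertex y'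
  · obtain rfl := eq_of_vertex_face hprime hv hf
    have h3 := eq_of_vertex_face hprime (by rw [D.vertex_rot_pow, D.vertex_rot_pow]) h
    exact ⟨rfl, D.rot_pow_inj (by omega) (by omega) h3⟩
  · obtain ⟨rfl, h1⟩ := boundary_face_aux hprime hmin hf hv hj hj' h
    obtain ⟨rfl, h2⟩ := boundary_face_aux hprime hmin hf.symm (Ne.symm hv) hj' (Or.inl rfl) h.symm
    have h3 : D.rot y' = D.flip (D.rot y) := eq_of_parallel hprime hmin
      (by rw [D.vertex_rot, h1]) (by rw [h2, D.flip_flip, D.vertex_rot])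
    rw [pow_one, h3, D.face_flip_rot] at h
    exact (face_rot_pow_ne hprime rfl (j := 1) (by decide) (by decide) h).elim

/-- An edge reached from both of its ends has both ends on the region of `y`, so it is a side of it;
but exponents 2 and 3 select the edges at a corner that are not. -/
theorem boundary_edge_inj (hmin : D.IsMinimal) {y y' : δ} {j j' : ℕ}
    (hf : D.face y = D.face y') (hj : j = 2 ∨ j = 3) (hj' : j' = 2 ∨ j' = 3)
    (h : D.edge ((D.rot ^ j) y) = D.edge ((D.rot ^ j') y')) : y = y' ∧ j = j' := by
  rcases D.eq_or_eq_flip h with h | h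
  · have hv : D.vertex y = D.vertex y' := by
      rw [← D.vertex_rot_pow j y, ← D.vertex_rot_pow j' y', h]
    obtain rfl := eq_of_vertex_face hprime hv hf
    exact ⟨rfl, (D.rot_pow_inj (by omega) (by omega) h).symm⟩
  · exfalso
    have := face_eq_or_of_isCorner hprime hmin (R := D.face y) (d := (D.rot ^ j) y)
      (by rw [D.vertex_rot_pow]; exact isCorner_face y)
      (by rw [← h, D.vertex_rot_pow, hf]; exact isCorner_face y')
    obtain ⟨i, rfl⟩ : ∃ i, j = i + 1 := ⟨j - 1, by omega⟩
    rw [face_flip_rot_pow_succ] at this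
    rcases this with h | h
    · exact face_rot_pow_ne hprime rfl (by omega) (by omega) h
    · exact face_rot_pow_ne hprime rfl (by omega) (by omega) h

end Prime

end DoodleDiagram

/-! ### The disc: counts, boundary circle and connectedness. -/

theorem Set.ncard_eq_sub_of_compl {α : Type*} [Finite α] {s t : Set α} (h : s = tᶜ) {a b : ℕ}
    (ha : Nat.card α = a) (hb : t.ncard = b) : (s.ncard : ℤ) = a - b := by
  subst h ha hb
  have := Set.ncard_add_ncard_compl t
  omega

/-- A sequence of vertices and edges that closes up after `m` steps is numbered by `ZMod m`. -/
theorem CellMap.Subcomplex.boundaryIsCircle_of_nat {δ : Type*} {M : CellMap δ} {K : M.Subcomplex}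
    {m : ℕ} (hm : 1 < m) (b : ℕ → M.Vertex) (c : ℕ → M.Edge)
    (hb : Set.InjOn b (Set.Iio m)) (hc : Set.InjOn c (Set.Iio m))
    (hb' : b '' Set.Iio m = K.boundaryVerts) (hc' : c '' Set.Iio m = K.boundaryEdges)
    (hbm : b m = b 0) (hj : ∀ i < m, M.Joins (c i) (b i) (b (i + 1))) : K.BoundaryIsCircle := by
  have : NeZero m := ⟨by omega⟩
  have : Fact (1 < m) := ⟨hm⟩
  have hrange : Set.range (ZMod.val : ZMod m → ℕ) = Set.Iio m := by
    ext k
    constructor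
    · rintro ⟨z, rfl⟩
      exact z.val_lt
    · intro hk
      exact ⟨k, ZMod.val_cast_of_lt hk⟩
  refine ⟨m, by omega, fun z => b z.val, fun z => c z.val,
    fun z z' h => ZMod.val_injective m (hb z.val_lt z'.val_lt h),
    fun z z' h => ZMod.val_injective m (hc z.val_lt z'.val_lt h), ?_, ?_, fun z => ?_⟩
  · rw [← hb', ← hrange, ← Set.range_comp]
    rfl
  · rw [← hc', ← hrange, ← Set.range_comp]
    rfl
  · have h : b (z + 1).val = b (z.val + 1) := by
      rw [ZMod.val_add, ZMod.val_one]
      rcases Nat.lt_or_ge (z.val + 1) m with h | h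
      · rw [Nat.mod_eq_of_lt h]
      · have h' : z.val + 1 = m := le_antisymm z.val_lt h
        rw [h', Nat.mod_self, hbm]
    change M.Joins (c z.val) (b z.val) (b (z + 1).val)
    rw [h]
    exact hj _ z.val_lt

namespace CellMap

variable {δ : Type*} (M : CellMap δ)

theorem card_darts_eq_two_mul_card_edge [Finite δ] : Nat.card δ = 2 * Nat.card M.Edge := by
  have := Fintype.ofFinite M.Edge
  rw [Nat.card_congr (Equiv.sigmaFiberEquiv M.edge).symm, Nat.card_sigma]
  have h : ∀ e, Nat.card {d // M.edge d = e} = 2 := by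
    intro e
    obtain ⟨d, rfl⟩ := M.edge_surjective e
    have h2 : {x | M.edge x = M.edge d} = {d, M.flip d} := by
      ext x
      simp [eq_comm (b := M.edge d), M.edge_eq_iff]
    change Nat.card ({x | M.edge x = M.edge d} : Set δ) = 2
    rw [Nat.card_coe_set_eq, h2, Set.ncard_pair (M.flip_ne d).symm]
  simp [h, mul_comm]

theorem card_darts_eq_mul_card_vertex [Finite δ] {k : ℕ} (h : ∀ v, M.valency v = k) :
    Nat.card δ = k * Nat.card M.Vertex := by
  have := Fintype.ofFinite M.Vertex
  rw [Nat.card_congr (Equiv.sigmaFiberEquiv M.vertex).symm, Nat.card_sigma]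
  change ∑ v, M.valency v = _
  simp [h, mul_comm]

end CellMap

namespace DoodleDiagram

variable {δ : Type*} {D : DoodleDiagram δ}

theorem card_edge [Finite δ] : Nat.card D.Edge = 2 * Nat.card D.Crossing := by
  have h1 := D.card_darts_eq_two_mul_card_edge
  have h2 : Nat.card δ = 4 * Nat.card D.Crossing := D.card_darts_eq_mul_card_vertex D.four_valent
  omega

theorem card_region [Finite δ] : Nat.card D.Region = Nat.card D.Crossing + 2 := by
  have := Fintype.ofFinite D.Edge
  have h1 : Nat.card D.Crossing + Nat.card D.Region = Nat.card D.Edge + 2 :=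
    (D.euler_and_dual_exact D.connected D.planar).1
  have h2 := D.card_edge
  omega

/-- The dual decomposition away from the infinite region. -/
abbrev finitePart (D : DoodleDiagram δ) (R : D.Region) : D.dualGraph.Subcomplex :=
  D.dualGraph.awayFrom (D.regionVertex R)

theorem isEnd_dual_iff {R : D.Region} {d : δ} :
    D.dualGraph.IsEnd (D.regionVertex R) (D.dualGraph.edge d) ↔
      D.face d = R ∨ D.face (D.flip d) = R := by
  constructor
  · rintro ⟨d', hd', h⟩
    rcases D.dualGraph.eq_or_eq_flip hd'.symm with rfl | rfl
    · exact Or.inl h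
    · exact Or.inr h
  · rintro (h | h)
    · exact ⟨d, rfl, h⟩
    · exact ⟨D.flip d, D.dualGraph.edge_flip d, h⟩

theorem mem_edges_finitePart {R : D.Region} {d : δ} :
    D.dualGraph.edge d ∈ (D.finitePart R).edges ↔ D.face d ≠ R ∧ D.face (D.flip d) ≠ R := by
  change ¬ D.dualGraph.IsEnd (D.regionVertex R) (D.dualGraph.edge d) ↔ _
  rw [isEnd_dual_iff, not_or]

theorem mem_faces_finitePart {R : D.Region} {f : D.dualGraph.Face} :
    f ∈ (D.finitePart R).faces ↔ ¬ D.IsCorner (D.dualFaceEquiv f) R :=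
  not_congr D.dual_isCorner_iff

theorem dual_joins {d : δ} {f g : D.Region} (hf : D.face d = g) (hg : D.face (D.flip d) = f) :
    D.dualGraph.Joins (D.dualGraph.edge d) (D.regionVertex f) (D.regionVertex g) :=
  ⟨D.flip d, D.dualGraph.edge_flip d, hg, by
    change D.face (D.flip (D.flip d)) = g
    rw [D.flip_flip, hf]⟩

theorem ncard_verts_finitePart [Finite δ] {R : D.Region} :
    (D.finitePart R).verts.ncard = Nat.card D.Crossing + 1 := by
  have h : ((D.finitePart R).verts.ncard : ℤ) = (Nat.card D.Crossing + 2 : ℕ) - (1 : ℕ) :=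
    Set.ncard_eq_sub_of_compl (α := D.Region) (t := {R}) rfl card_region (Set.ncard_singleton _)
  omega

section Prime

variable [Finite δ] (hprime : D.IsPrime)
include hprime

theorem ncard_edges_finitePart {R : D.Region} :
    ((D.finitePart R).edges.ncard : ℤ) = 2 * Nat.card D.Crossing - D.sides R := by
  have h := Set.ncard_eq_sub_of_compl (α := D.Edge) (s := (D.finitePart R).edges)
    (t := D.edge '' {d | D.face d = R}) (b := D.sides R) (by
      ext e
      obtain ⟨d, rfl⟩ := D.edge_surjective e
      refine mem_edges_finitePart.trans ?_
      refine not_or.symm.trans (not_congr ?_)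
      constructor
      · rintro (h | h)
        · exact ⟨d, h, rfl⟩
        · exact ⟨D.flip d, h, D.edge_flip d⟩
      · rintro ⟨d', h, hd⟩
        rcases D.eq_or_eq_flip hd with rfl | rfl
        · exact Or.inl h
        · rw [D.flip_flip]
          exact Or.inr h) card_edge (edge_injOn_face hprime R).ncard_image
  push_cast at h
  exact h

theorem ncard_faces_finitePart {R : D.Region} :
    ((D.finitePart R).faces.ncard : ℤ) = Nat.card D.Crossing - D.sides R := by
  refine Set.ncard_eq_sub_of_compl (t := D.dualFaceEquiv ⁻¹' (D.vertex '' {d | D.face d = R})) ?_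
    (Nat.card_congr D.dualFaceEquiv) ?_
  · ext f
    exact mem_faces_finitePart
  · rw [Set.ncard_preimage_of_injective_subset_range D.dualFaceEquiv.injective
      (by simp [D.dualFaceEquiv.range_eq_univ]), (vertex_injOn_face hprime R).ncard_image]
    rfl

/-- The face surrounds a crossing. Its edges differ as there are no loops, its vertices as no region
touches a crossing twice. -/
theorem isFourSided_dual (f : D.dualGraph.Face) : D.dualGraph.IsFourSided f := by
  obtain ⟨v, hv⟩ : ∃ v, D.dualFaceEquiv f = v := ⟨_, rfl⟩
  refine ⟨?_, ?_, ?_⟩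
  · rw [← D.four_valent v, ← hv]
    exact Nat.card_congr (D.flip.subtypeEquiv fun d => D.dual_face_eq_iff')
  · intro d hd d' hd' h
    rcases D.eq_or_eq_flip h with rfl | rfl
    · rfl
    · have h1 := D.dual_face_eq_iff'.1 hd
      have h2 := D.dual_face_eq_iff'.1 hd'
      exact (vertex_flip_ne hprime (D.flip d) (h2.trans h1.symm)).elim
  · intro d hd d' hd' h
    have h1 := D.dual_face_eq_iff'.1 hd
    have h2 := D.dual_face_eq_iff'.1 hd'
    exact D.turn.injective (eq_of_vertex_face hprime
      (by rw [D.vertex_turn, D.vertex_turn, h1, h2])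
      (by rw [D.face_turn, D.face_turn]; exact h))

/-- Dual faces outside the disc are the crossings on `R`; exponent 3 is omitted because it is
exponent 1 at the next corner. -/
theorem mem_boundaryVerts_iff {R f : D.Region} :
    D.regionVertex f ∈ (D.finitePart R).boundaryVerts ↔
      ∃ y j, D.face y = R ∧ (j = 1 ∨ j = 2) ∧ D.face ((D.rot ^ j) y) = f := by
  constructor
  · rintro ⟨hfR, g, hg, hfg⟩
    rw [mem_faces_finitePart, not_not] at hg
    obtain ⟨y, hy, hyv⟩ := hg
    obtain ⟨z, hz, hzv⟩ := D.dual_isCorner_iff.1 hfg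
    obtain ⟨j, hj, rfl⟩ := D.exists_rot_pow (hyv.trans hzv.symm)
    have hj0 : j ≠ 0 := by
      rintro rfl
      exact hfR (hz.symm.trans hy)
    by_cases hj3 : j = 3
    · subst hj3
      rw [face_rot_pow_three] at hz
      exact ⟨D.turn y, 1, (D.face_turn y).trans hy, Or.inl rfl, hz⟩
    · exact ⟨y, j, hy, by omega, hz⟩
  · rintro ⟨y, j, hy, hj, rfl⟩
    refine ⟨face_rot_pow_ne hprime hy (by omega) (by omega), D.dual.face (D.flip y), ?_, ?_⟩
    · rw [mem_faces_finitePart, not_not, D.dualFaceEquiv_face, D.flip_flip]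
      exact ⟨y, hy, rfl⟩
    · refine D.dual_isCorner_iff.2 ?_
      rw [D.dualFaceEquiv_face, D.flip_flip]
      exact ⟨_, rfl, D.vertex_rot_pow j y⟩

/-- At a corner of `R` the darts with exponents 0 and 1 have `R` on their left and right; the other
two remain. -/
theorem mem_boundaryEdges_iff {R : D.Region} {e : D.dualGraph.Edge} :
    e ∈ (D.finitePart R).boundaryEdges ↔
      ∃ y j, D.face y = R ∧ (j = 2 ∨ j = 3) ∧ D.dualGraph.edge ((D.rot ^ j) y) = e := by
  constructor
  · rintro ⟨he, g, hg, d, rfl, rfl⟩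
    rw [mem_faces_finitePart, not_not, D.dualFaceEquiv_face] at hg
    obtain ⟨y, hy, hyv⟩ := hg
    obtain ⟨j, hj, hjd⟩ := D.exists_rot_pow hyv
    rw [mem_edges_finitePart] at he
    refine ⟨y, j, hy, ?_, ?_⟩
    · by_contra hcon
      have : j = 0 ∨ j = 1 := by omega
      rcases this with rfl | rfl
      · exact he.2 (by rw [← hjd]; exact hy)
      · refine he.1 ?_
        rw [← D.flip_flip d, ← hjd, pow_one, D.face_flip_rot, hy]
    · rw [hjd]
      exact D.dualGraph.edge_flip d
  · rintro ⟨y, j, hy, hj, rfl⟩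
    obtain ⟨i, rfl⟩ : ∃ i, j = i + 1 := ⟨j - 1, by omega⟩
    refine ⟨mem_edges_finitePart.2 ⟨face_rot_pow_ne hprime hy (by omega) (by omega), ?_⟩,
      D.dual.face (D.flip ((D.rot ^ (i + 1)) y)), ?_, _, D.dualGraph.edge_flip _, rfl⟩
    · rw [face_flip_rot_pow_succ]
      exact face_rot_pow_ne hprime hy (by omega) (by omega)
    · rw [mem_faces_finitePart, not_not, D.dualFaceEquiv_face, D.flip_flip]
      exact ⟨y, hy, (D.vertex_rot_pow _ y).symm⟩

/-- A path of regions through `R` can be rerouted around `R`: the regions at its corners are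
connected to each other by turning about one corner after another. -/
theorem connected_skeleton_finitePart {R : D.Region} : (D.finitePart R).skeleton.Connected := by
  obtain ⟨y₀, hy₀⟩ := D.face_surjective R
  have hstart := face_rot_pow_ne hprime hy₀ (j := 1) (by decide) (by decide)
  let b : (D.finitePart R).verts := ⟨D.regionVertex (D.face ((D.rot ^ 1) y₀)), hstart⟩
  let P : D.Region → Prop := fun f =>
    ∃ h : f ≠ R, (D.finitePart R).skeleton.Reachable b ⟨D.regionVertex f, h⟩
  have hstep : ∀ d, P (D.face d) → D.face (D.flip d) ≠ R → P (D.face (D.flip d)) := by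
    rintro d ⟨h, hr⟩ h'
    refine ⟨h', hr.trans (SimpleGraph.Adj.reachable ⟨fun he => face_flip_ne hprime d
      (congrArg Subtype.val he).symm,
      D.dualGraph.edge d, mem_edges_finitePart.2 ⟨h, h'⟩, d, rfl, rfl, rfl⟩)⟩
  have hturn : ∀ y, D.face y = R → P (D.face ((D.rot ^ 1) y)) →
      P (D.face ((D.rot ^ 1) (D.turn y))) := by
    intro y hy h1
    have h2 : P (D.face ((D.rot ^ 2) y)) := by
      have := hstep (D.flip ((D.rot ^ (1 + 1)) y)) (by rwa [face_flip_rot_pow_succ])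
      rw [D.flip_flip] at this
      exact this (face_rot_pow_ne hprime hy (by decide) (by decide))
    have h3 : P (D.face ((D.rot ^ 3) y)) := by
      have := hstep (D.flip ((D.rot ^ (2 + 1)) y)) (by rwa [face_flip_rot_pow_succ])
      rw [D.flip_flip] at this
      exact this (face_rot_pow_ne hprime hy (by decide) (by decide))
    rwa [face_rot_pow_three] at h3
  have hround : ∀ y, D.face y = R → P (D.face ((D.rot ^ 1) y)) := by
    intro y hy
    obtain ⟨i, -, rfl⟩ := (D.face_eq_iff.1 (hy₀.trans hy.symm)).exists_pow_eq'
    clear hy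
    induction i with
    | zero => exact ⟨hstart, SimpleGraph.Reachable.refl _⟩
    | succ i ih =>
      rw [pow_succ' D.turn, Equiv.Perm.mul_apply]
      exact hturn _ ((D.face_turn_pow i y₀).trans hy₀) ih
  have hflip : ∀ d, D.face d = R ∨ P (D.face d) →
      D.face (D.flip d) = R ∨ P (D.face (D.flip d)) := by
    rintro d (h | h)
    · right
      have := hround (D.turn d) ((D.face_turn d).trans h)
      rwa [pow_one, face_rot_turn] at this
    · by_cases h' : D.face (D.flip d) = R
      · exact Or.inl h'
      · exact Or.inr (hstep d h h')
  have hall : ∀ f, f = R ∨ P f := fun f =>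
    (D.eq_of_face_flip_eq D.connected (fun f => f = R ∨ P f) (fun d => propext
      ⟨hflip d, fun h => by simpa only [D.flip_flip] using hflip (D.flip d) h⟩) R f).mp (Or.inl rfl)
  have hreach : ∀ v, (D.finitePart R).skeleton.Reachable b v := by
    rintro ⟨f, hf⟩
    obtain ⟨_, h⟩ := (hall f).resolve_left hf
    exact h
  have : Nonempty (D.finitePart R).verts := ⟨b⟩
  exact ⟨fun u w => (hreach u).symm.trans (hreach w)⟩

theorem boundary_finitePart (hmin : D.IsMinimal) {R : D.Region} :
    (D.finitePart R).BoundaryIsCircle ∧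
      (D.finitePart R).boundaryVerts.ncard = 2 * D.sides R ∧
      (D.finitePart R).boundaryEdges.ncard = 2 * D.sides R := by
  obtain ⟨y₀, hy₀⟩ := D.face_surjective R
  obtain ⟨p, hp⟩ : ∃ p, p = D.sides R := ⟨_, rfl⟩
  have hp3 : 3 ≤ p := hp ▸ hmin R
  obtain ⟨hper, hinj, hsurj⟩ := D.turn.card_sameCycle_cases y₀
    (CellMap.card_sameCycle_face hp.symm hy₀)
  rw [← hp]
  have hface : ∀ i, D.face ((D.turn ^ i) y₀) = R := fun i => (D.face_turn_pow i y₀).trans hy₀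
  -- Two vertices and two edges per corner: `k / 2` counts corners along `R`, and the parity of `k`
  -- picks the exponent, 1 or 2 for vertices and 2 or 3 for edges.
  let b : ℕ → D.dualGraph.Vertex := fun k =>
    D.regionVertex (D.face ((D.rot ^ (k % 2 + 1)) ((D.turn ^ (k / 2)) y₀)))
  let c : ℕ → D.dualGraph.Edge := fun k =>
    D.dualGraph.edge ((D.rot ^ (k % 2 + 2)) ((D.turn ^ (k / 2)) y₀))
  have hb : Set.InjOn b (Set.Iio (2 * p)) := by
    intro k hk l hl h
    rw [Set.mem_Iio] at hk hl
    obtain ⟨h1, h2⟩ := boundary_face_inj hprime hmin ((hface _).trans (hface _).symm)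
      (by omega) (by omega) h
    have := hinj _ (by omega) _ (by omega) h1
    omega
  have hc : Set.InjOn c (Set.Iio (2 * p)) := by
    intro k hk l hl h
    rw [Set.mem_Iio] at hk hl
    obtain ⟨h1, h2⟩ := boundary_edge_inj hprime hmin ((hface _).trans (hface _).symm)
      (by omega) (by omega) h
    have := hinj _ (by omega) _ (by omega) h1
    omega
  have hb' : b '' Set.Iio (2 * p) = (D.finitePart R).boundaryVerts := by
    ext f
    refine Iff.trans ?_ (mem_boundaryVerts_iff hprime (f := f)).symm
    constructor
    · rintro ⟨k, -, rfl⟩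
      exact ⟨_, _, hface _, by omega, rfl⟩
    · rintro ⟨y, j, hy, hj, rfl⟩
      obtain ⟨i, hi, rfl⟩ := hsurj y (D.face_eq_iff.1 (hy₀.trans hy.symm))
      refine ⟨2 * i + (j - 1), by rw [Set.mem_Iio]; omega, ?_⟩
      change D.face ((D.rot ^ ((2 * i + (j - 1)) % 2 + 1))
        ((D.turn ^ ((2 * i + (j - 1)) / 2)) y₀)) = _
      rw [show (2 * i + (j - 1)) % 2 + 1 = j by omega, show (2 * i + (j - 1)) / 2 = i by omega]
  have hc' : c '' Set.Iio (2 * p) = (D.finitePart R).boundaryEdges := by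
    ext e
    refine Iff.trans ?_ (mem_boundaryEdges_iff hprime).symm
    constructor
    · rintro ⟨k, -, rfl⟩
      exact ⟨_, _, hface _, by omega, rfl⟩
    · rintro ⟨y, j, hy, hj, rfl⟩
      obtain ⟨i, hi, rfl⟩ := hsurj y (D.face_eq_iff.1 (hy₀.trans hy.symm))
      refine ⟨2 * i + (j - 2), by rw [Set.mem_Iio]; omega, ?_⟩
      change D.dualGraph.edge ((D.rot ^ ((2 * i + (j - 2)) % 2 + 2))
        ((D.turn ^ ((2 * i + (j - 2)) / 2)) y₀)) = _
      rw [show (2 * i + (j - 2)) % 2 + 2 = j by omega, show (2 * i + (j - 2)) / 2 = i by omega]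
  refine ⟨CellMap.Subcomplex.boundaryIsCircle_of_nat (by omega) b c hb hc hb' hc' ?_ ?_, ?_, ?_⟩
  · change D.face ((D.rot ^ (2 * p % 2 + 1)) ((D.turn ^ (2 * p / 2)) y₀)) =
      D.face ((D.rot ^ 1) y₀)
    rw [show 2 * p % 2 + 1 = 1 by omega, show 2 * p / 2 = p by omega, hper]
  · intro k _
    refine dual_joins ?_ (face_flip_rot_pow_succ _ _)
    rcases Nat.mod_two_eq_zero_or_one k with hk | hk
    · rw [hk, show (k + 1) % 2 = 1 by omega, show (k + 1) / 2 = k / 2 by omega]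
    · rw [hk, show (k + 1) % 2 = 0 by omega, show (k + 1) / 2 = k / 2 + 1 by omega,
        pow_succ' D.turn, Equiv.Perm.mul_apply]
      exact face_rot_pow_three _
  · rw [← hb', hb.ncard_image, Set.ncard_Iio_nat]
  · rw [← hc', hc.ncard_image, Set.ncard_Iio_nat]

theorem isDisc_finitePart (hmin : D.IsMinimal) (R : D.Region) : (D.finitePart R).IsDisc := by
  refine ⟨connected_skeleton_finitePart hprime, (boundary_finitePart hprime hmin).1, ?_⟩
  rw [ncard_verts_finitePart, ncard_edges_finitePart hprime, ncard_faces_finitePart hprime]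
  push_cast
  ring

/-- Faces of the disc are crossings off `R`, and neighbouring crossings give adjacent faces. -/
theorem exists_two_adjacent_faces (hmin : D.IsMinimal) {R : D.Region} {f : D.dualGraph.Face}
    (hf : f ∈ (D.finitePart R).faces) :
    ∃ g ∈ (D.finitePart R).faces, ∃ h ∈ (D.finitePart R).faces,
      g ≠ f ∧ h ≠ f ∧ g ≠ h ∧ D.dualGraph.FaceAdj f g ∧ D.dualGraph.FaceAdj f h := by
  obtain ⟨x, rfl⟩ := D.dualGraph.face_surjective f
  rw [mem_faces_finitePart, D.dualFaceEquiv_face] at hf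
  obtain ⟨y, z, hy, hz, hyz, hyR, hzR⟩ := exists_two_neighbours_off hprime hmin hf
  have hmem : ∀ y, ¬ D.IsCorner (D.vertex (D.flip y)) R →
      D.dualGraph.face y ∈ (D.finitePart R).faces := fun y h => by
    rwa [mem_faces_finitePart, D.dualFaceEquiv_face]
  have hne : ∀ y, D.vertex y = D.vertex (D.flip x) →
      D.dualGraph.face y ≠ D.dualGraph.face x := fun y h h' =>
    vertex_flip_ne hprime y ((D.dual_face_eq_iff.1 h').trans h.symm)
  have hadj : ∀ y, D.vertex y = D.vertex (D.flip x) →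
      D.dualGraph.FaceAdj (D.dualGraph.face x) (D.dualGraph.face y) := fun y h =>
    ⟨D.flip y, D.dual_face_eq_iff.2 (by rw [D.flip_flip, h]), by
      change D.dualGraph.face (D.flip (D.flip y)) = _
      rw [D.flip_flip]⟩
  exact ⟨_, hmem y hyR, _, hmem z hzR, hne y hy, hne z hz, fun h => hyz
    (eq_of_parallel hprime hmin (hy.trans hz.symm) (D.dual_face_eq_iff.1 h)), hadj y hy, hadj z hz⟩

end Prime

/-- Dual valency is the number of sides by definition, so only the removal of `R` matters. -/
theorem ncard_valency_finitePart (R : D.Region) (i : ℕ) :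
    {v ∈ (D.finitePart R).verts | D.dualGraph.valency v = i} =
      ({f | D.sides f = i} \ {R} : Set D.Region) :=
  Set.ext fun _ => and_comm

end DoodleDiagram

theorem lemma7p9 {δ : Type*} [Finite δ] (D : DoodleDiagram δ)
    (hmin : D.IsMinimal) (hprime : D.IsPrime)
    (n : ℕ) (hn : Nat.card D.Crossing = n)
    (R : D.Region) (p : ℕ) (hp : D.toCellMap.sides R = p) :
    let Γ : CellMap δ := D.dualGraph
    let vInf : Γ.Vertex := D.regionVertex R
    let Δ : Γ.Subcomplex := Γ.awayFrom vInf
    (Nat.card Γ.Vertex = n + 2 ∧ Nat.card Γ.Edge = 2 * n ∧ Nat.card Γ.Face = n) ∧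
    Δ.IsDisc ∧
    Δ.verts.ncard = n + 1 ∧
    (Δ.boundaryEdges.ncard = 2 * p ∧ Δ.boundaryVerts.ncard = 2 * p) ∧
    ((Δ.interiorEdges.ncard : ℤ) = 2 * n - 3 * p ∧
      (Δ.interiorVerts.ncard : ℤ) = n + 1 - 2 * p) ∧
    ((Δ.faces.ncard : ℤ) = n - p ∧ ∀ f ∈ Δ.faces, Γ.IsFourSided f) ∧
    (({v ∈ Δ.verts | Γ.valency v = p}.ncard : ℤ) = D.numGons p - 1 ∧
      ∀ i, 3 ≤ i → i ≠ p → {v ∈ Δ.verts | Γ.valency v = i}.ncard = D.numGons i) ∧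
    (∀ f ∈ Δ.faces, ∃ g ∈ Δ.faces, ∃ h ∈ Δ.faces,
      g ≠ f ∧ h ≠ f ∧ g ≠ h ∧ Γ.FaceAdj f g ∧ Γ.FaceAdj f h) ∧
    (∀ u v e e', Γ.Joins e u v → Γ.Joins e' u v → e = e') := by
  intro Γ vInf Δ
  subst hn hp
  have hB := DoodleDiagram.boundary_finitePart hprime hmin (R := R)
  have hE := DoodleDiagram.ncard_edges_finitePart hprime (R := R)
  have hV := DoodleDiagram.ncard_verts_finitePart (D := D) (R := R)
  have hp : 3 ≤ D.sides R := hmin R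
  refine ⟨⟨DoodleDiagram.card_region, DoodleDiagram.card_edge, Nat.card_congr D.dualFaceEquiv⟩,
    DoodleDiagram.isDisc_finitePart hprime hmin R, hV, ⟨hB.2.2, hB.2.1⟩, ⟨?_, ?_⟩,
    ⟨DoodleDiagram.ncard_faces_finitePart hprime,
      fun f _ => DoodleDiagram.isFourSided_dual hprime f⟩, ⟨?_, ?_⟩,
    fun f hf => DoodleDiagram.exists_two_adjacent_faces hprime hmin hf, ?_⟩
  · have h : Δ.boundaryEdges ⊆ Δ.edges := Set.sep_subset _ _
    have h1 : Δ.interiorEdges.ncard + Δ.boundaryEdges.ncard = Δ.edges.ncard :=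
      Set.ncard_sdiff_add_ncard_of_subset h (Set.toFinite _)
    have h2 : Δ.boundaryEdges.ncard = 2 * D.sides R := hB.2.2
    have h3 : (Δ.edges.ncard : ℤ) = 2 * Nat.card D.Crossing - D.sides R := hE
    omega
  · have h : Δ.boundaryVerts ⊆ Δ.verts := Set.sep_subset _ _
    have h1 : Δ.interiorVerts.ncard + Δ.boundaryVerts.ncard = Δ.verts.ncard :=
      Set.ncard_sdiff_add_ncard_of_subset h (Set.toFinite _)
    have h2 : Δ.boundaryVerts.ncard = 2 * D.sides R := hB.2.1
    have h3 : Δ.verts.ncard = Nat.card D.Crossing + 1 := hV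
    omega
  · have h1 := Set.ncard_sdiff_singleton_add_one (s := {f : D.Region | D.sides f = D.sides R})
      (a := R) rfl (Set.toFinite _)
    rw [← DoodleDiagram.ncard_valency_finitePart, ← Nat.card_coe_set_eq {f | _}] at h1
    change _ = D.numGons (D.sides R) at h1
    rw [← h1]
    push_cast
    exact (add_sub_cancel_right _ _).symm
  · intro i _ hi
    refine (congrArg Set.ncard (DoodleDiagram.ncard_valency_finitePart R i)).trans ?_
    exact congrArg Set.ncard (Set.sdiff_singleton_eq_self (s := {f : D.Region | D.sides f = i})
      (fun h : D.sides R = i => hi h.symm))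
  · rintro u v _ _ ⟨d, rfl, rfl, rfl⟩ ⟨d', rfl, h1, h2⟩
    exact congrArg Γ.edge (DoodleDiagram.eq_of_face_face_flip hprime hmin h1.symm h2.symm)
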